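/- Let $\mathcal G=(X,E)$ be a finite connected graph without loop-edges or multiple edges, with conductances $C_{x,y}=C_{y,x}\ge 0$ (vanishing when $\{x,y\}\notin E$) and a killing measure $\kappa\ge 0$ on $X$ such that the energy $$\mathcal E(f,f)=\tfrac12\sum_{x,y}C_{x,y}(f(x)-f(y))^2+\sum_x\kappa_x f(x)^2$$ is positive definite. Set $\lambda_x=\sum_y C_{x,y}+\kappa_x$ and $P_{x,y}=C_{x,y}/\lambda_x$. Let $\mu$ be the loop measure of the continuous time Markov chain $(X_t)$ which has transition matrix $P$ (with killing when $\sum_y P_{x,y}<1$) and independent exponential holding times of mean $1$: $\mu$ is the image, on loops considered up to circular time shift, of the measure $\int_0^\infty \frac1t\sum_{x\in X}\mathbb P_x\big((X_s)_{0\le s\le t}\in\cdot\,,\,X_t=x\big)\,dt$ on based loops. Let $\mathcal L_{1/2}$ be a Poisson process of loops with intensity $\frac12\mu$, let $N^{(1/2)}_{x,y}$ be the total number of jumps from $x$ to $y$ made by the loops of $\mathcal L_{1/2}$, and for $\{x,y\}\in E$ let $N^{(1/2)}_{\{x,y\}}=N^{(1/2)}_{x,y}+N^{(1/2)}_{y,x}$.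 Let $\mathfrak C^{ev}$ be the set of numbered $\mathcal G$-maps with an even number of incident edges at each vertex: an element $c$ is given by attaching to each $x\in X$ a number $2c_x$ ($c_x\in\mathbb N$) of half-edges, numbered from $1$ to $2c_x$, and by coupling all the half-edges in pairs so that each pair consists of half-edges attached to adjacent vertices of $\mathcal G$. For $e=\{x,y\}\in E$ let $c_e$ be the number of coupled pairs with one half-edge at $x$ and the other at $y$. **Theorem.** The measure $Q^{ev}$ defined on $\mathfrak C^{ev}$ by $$Q^{ev}(c)=\sqrt{\det(I-P)}\;\prod_{x\in X}\frac{1}{2^{c_x}\,c_x!}\;\prod_{\{x,y\}\in E}\Big(\sqrt{P_{x,y}P_{y,x}}\Big)^{c_{\{x,y\}}}$$ is a probability measure, and its image under $c\mapsto (c_e)_{e\in E}$ is the distribution of the edge occupation field $(N^{(1/2)}_e)_{e\in E}$. -/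

import Mathlib

open MeasureTheory ProbabilityTheory
open scoped ENNReal NNReal

noncomputable section

namespace LoopNetwork

/-! ### The energy and the transition matrix -/

/-- The energy `½ ∑_{x,y} C_{x,y} (f x - f y)² + ∑_x κ_x (f x)²`. -/
def energy {X : Type*} [Fintype X] (C : X → X → ℝ) (κ : X → ℝ) (f : X → ℝ) : ℝ :=
  (1 / 2) * ∑ x, ∑ y, C x y * (f x - f y) ^ 2 + ∑ x, κ x * f x ^ 2

/-- The duality measure `λ_x = ∑_y C_{x,y} + κ_x`. -/
def duality {X : Type*} [Fintype X] (C : X → X → ℝ) (κ : X → ℝ) (x : X) : ℝ :=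
  ∑ y, C x y + κ x

/-- The transition matrix `P_{x,y} = C_{x,y} / λ_x`. -/
def transition {X : Type*} [Fintype X] (C : X → X → ℝ) (κ : X → ℝ) : Matrix X X ℝ :=
  Matrix.of fun x y => C x y / duality C κ x

/-! ### Continuous time loops and the loop measure -/

/-- The sequence of sites `ξ_0, …, ξ_n` (with `ξ_n = ξ_0`) visited by a based loop with
`n` jumps. -/
structure Itinerary (X : Type*) where
  /-- the number of jumps -/
  n : ℕ
  /-- the successive sites -/
  site : Fin (n + 1) → X
  closed : site (Fin.last n) = site 0

/-- A based loop: the path that starts at `ξ_0`, stays at `ξ_i` during a time `τ_i`, then jumps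
to `ξ_{i+1}`, and is stopped after the time `τ_n` spent at `ξ_n = ξ_0`; its duration is
`τ_0 + … + τ_n`. (The loop measure lives on positive `τ`.) -/
abbrev BasedLoop (X : Type*) := Σ s : Itinerary X, (Fin (s.n + 1) → ℝ)

/-- The based loop measure `∫_0^∞ (1/t) ∑_x ℙ_x(· ; X_t = x) dt` of the continuous time Markov
chain `X_t` with jump matrix `P` and independent exponential holding times of mean `1`. Under
`ℙ_x`, up to time `t`, the path with sites `ξ_0 = x, …, ξ_n` and jump times `s_1 < … < s_n < t` has
density `e^{-t} ∏ P_{ξ_{i-1}, ξ_i} ds_1 … ds_n`, and `ds_1 … ds_n dt = dτ_0 … dτ_n`. -/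
def basedLoopMeasure {X : Type*} (P : Matrix X X ℝ) : Measure (BasedLoop X) :=
  Measure.sum fun s : Itinerary X =>
    ENNReal.ofReal (∏ i : Fin s.n, P (s.site i.castSucc) (s.site i.succ)) •
      (((volume : Measure (Fin (s.n + 1) → ℝ)).restrict {τ | ∀ i, 0 < τ i}).withDensity
        (fun τ => ENNReal.ofReal (Real.exp (-∑ i, τ i) / ∑ i, τ i))).map (Sigma.mk s)

/-- A pointed loop: a cyclic sequence of sites `ξ_0, …, ξ_m` indexed by `ℤ/(m+1)`, with the times
`T_0, …, T_m` spent at them. A loop without jumps has `m = 0`. -/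
abbrev PointedLoop (X : Type*) := Σ s : (Σ m : ℕ, Fin (m + 1) → X), (Fin (s.1 + 1) → ℝ)

/-- Start the cyclic sequence at the index `r`. -/
def PointedLoop.rotate {X : Type*} (p : PointedLoop X) (r : Fin (p.1.1 + 1)) : PointedLoop X :=
  ⟨⟨p.1.1, fun i => p.1.2 (i + r)⟩, fun i => p.2 (i + r)⟩

theorem PointedLoop.mk_congr {X : Type*} {m : ℕ} {ξ ξ' : Fin (m + 1) → X} {T T' : Fin (m + 1) → ℝ}
    (h : ∀ i, ξ i = ξ' i) (h' : ∀ i, T i = T' i) :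
    (⟨⟨m, ξ⟩, T⟩ : PointedLoop X) = ⟨⟨m, ξ'⟩, T'⟩ := by
  obtain rfl : ξ = ξ' := funext h
  obtain rfl : T = T' := funext h'
  rfl

/-- Pointed loops are equivalent when they differ by a rotation. -/
def rotationSetoid (X : Type*) : Setoid (PointedLoop X) where
  r p q := ∃ r, q = p.rotate r
  iseqv :=
    { refl := by
        rintro ⟨⟨m, ξ⟩, T⟩
        exact ⟨(0 : Fin (m + 1)), PointedLoop.mk_congr
          (fun i => congrArg ξ (add_zero i).symm) (fun i => congrArg T (add_zero i).symm)⟩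
      symm := by
        rintro ⟨⟨m, ξ⟩, T⟩ q ⟨r, rfl⟩
        exact ⟨(-r : Fin (m + 1)), PointedLoop.mk_congr
          (fun i => congrArg ξ (neg_add_cancel_right i r).symm)
          (fun i => congrArg T (neg_add_cancel_right i r).symm)⟩
      trans := by
        rintro ⟨⟨m, ξ⟩, T⟩ q w ⟨(r : Fin (m + 1)), rfl⟩ ⟨(t : Fin (m + 1)), rfl⟩
        exact ⟨(t + r : Fin (m + 1)), PointedLoop.mk_congr
          (fun i => congrArg ξ (add_assoc i t r)) (fun i => congrArg T (add_assoc i t r))⟩ }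

/-- Loops: based loops up to a circular time shift, i.e. pointed loops up to rotation. -/
abbrev Loop (X : Type*) := Quotient (rotationSetoid X)

/-- Forget the base point in time: the two stays at the base site, at the beginning and at the
end of the path, are merged. -/
def BasedLoop.toPointed {X : Type*} : BasedLoop X → PointedLoop X
  | ⟨⟨0, ξ, _⟩, τ⟩ => ⟨⟨0, ξ⟩, τ⟩
  | ⟨⟨m + 1, ξ, _⟩, τ⟩ =>
      ⟨⟨m, fun i => ξ i.castSucc⟩,
        fun i => if i = 0 then τ 0 + τ (Fin.last (m + 1)) else τ i.castSucc⟩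

/-- The loop defined by a based loop. -/
def BasedLoop.toLoop {X : Type*} (b : BasedLoop X) : Loop X :=
  Quotient.mk (rotationSetoid X) (BasedLoop.toPointed b)

theorem BasedLoop.measurable_toLoop {X : Type*} :
    Measurable (BasedLoop.toLoop : BasedLoop X → Loop X) := by
  have hmk : Measurable (Quotient.mk (rotationSetoid X)) := fun _ h => h
  refine hmk.comp ?_
  have hs : ∀ a : (Σ m : ℕ, Fin (m + 1) → X),
      Measurable (fun T => (⟨a, T⟩ : PointedLoop X)) :=
    fun a _ h => MeasurableSpace.measurableSet_iInf.1 h a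
  intro A hA
  refine MeasurableSpace.measurableSet_iInf.2 fun s => ?_
  rcases s with ⟨_ | m, ξ, hξ⟩
  · exact hs ⟨0, ξ⟩ hA
  · have h1 : Measurable fun (τ : Fin (m + 1 + 1) → ℝ) (i : Fin (m + 1)) =>
        if i = 0 then τ 0 + τ (Fin.last (m + 1)) else τ i.castSucc := by
      refine measurable_pi_lambda _ fun i => ?_
      split_ifs <;> fun_prop
    exact h1 (hs ⟨m, fun i => ξ i.castSucc⟩ hA)

/-- The loop measure `μ`: the image of the based loop measure on loops. -/
def loopMeasure {X : Type*} (P : Matrix X X ℝ) : Measure (Loop X) :=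
  (basedLoopMeasure P).map BasedLoop.toLoop

/-- The number of jumps from `x` to `y` (none if `x = y`) of a pointed loop. -/
def PointedLoop.jumps {X : Type*} [DecidableEq X] (x y : X) (p : PointedLoop X) : ℕ :=
  Fintype.card {i : Fin (p.1.1 + 1) // x ≠ y ∧ p.1.2 i = x ∧ p.1.2 (i + 1) = y}

theorem PointedLoop.jumps_rotate {X : Type*} [DecidableEq X] (x y : X) (p : PointedLoop X)
    (r : Fin (p.1.1 + 1)) : (p.rotate r).jumps x y = p.jumps x y := by
  refine Fintype.card_congr ((Equiv.addRight r).subtypeEquiv ?_)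
  intro i
  have h : (i + 1 : Fin (p.1.1 + 1)) + r = i + r + 1 := add_right_comm i 1 r
  change (x ≠ y ∧ p.1.2 (i + r) = x ∧ p.1.2 (i + 1 + r) = y) ↔
    (x ≠ y ∧ p.1.2 (i + r) = x ∧ p.1.2 (i + r + 1) = y)
  rw [h]

/-- The number of jumps from `x` to `y` of a loop. -/
def Loop.jumps {X : Type*} [DecidableEq X] (x y : X) (l : Loop X) : ℕ :=
  Quotient.lift (s := rotationSetoid X) (PointedLoop.jumps x y)
    (by rintro p q ⟨r, rfl⟩; exact (PointedLoop.jumps_rotate x y p r).symm) l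

/-! ### Poisson processes and the edge occupation field -/

/-- `L` is a Poisson process of points of `S` (seen as a random counting measure) with intensity
measure `ν`. -/
structure IsPoissonProcess {Ω S : Type*} [MeasurableSpace Ω] [MeasurableSpace S]
    (Pr : Measure Ω) (L : Ω → Measure S) (ν : Measure S) : Prop where
  measurable : ∀ A, MeasurableSet A → Measurable fun ω => L ω A
  law : ∀ A, MeasurableSet A → ν A ≠ ∞ →
    Pr.map (fun ω => L ω A) = (poissonMeasure (ν A).toNNReal).map (fun n : ℕ => (n : ℝ≥0∞))
  law_top : ∀ A, MeasurableSet A → ν A = ∞ → ∀ᵐ ω ∂Pr, L ω A = ∞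
  indep : ∀ (n : ℕ) (A : Fin n → Set S), (∀ i, MeasurableSet (A i)) →
    Pairwise (fun i j => Disjoint (A i) (A j)) → iIndepFun (fun i ω => L ω (A i)) Pr

/-- The total number `N_{x,y}` of jumps from `x` to `y` made by the loops of the family `L`. -/
def jumpNumber {X : Type*} [DecidableEq X] (L : Measure (Loop X)) (x y : X) : ℝ≥0∞ :=
  ∫⁻ l, (Loop.jumps x y l : ℝ≥0∞) ∂L

/-- The edge occupation field `N_{ {x,y} } = N_{x,y} + N_{y,x}`. -/
def edgeField {X : Type*} [DecidableEq X] (G : SimpleGraph X) (L : Measure (Loop X)) :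
    G.edgeSet → ℝ≥0∞ :=
  fun e => Sym2.lift ⟨fun x y => jumpNumber L x y + jumpNumber L y x, fun _ _ => add_comm _ _⟩ e.1

/-! ### Even configurations and the measure on them -/

/-- A numbered `G`-map with an even number of incident edges at each vertex: at each vertex `x`
there are `2 c_x` half-edges, numbered in their cyclic order starting from the chosen first one, and
the half-edges are coupled in pairs, each pair forming a copy of an edge of `G`. (`G` has no
loop-edge, so that the involution `couple` has no fixed point. The vertices of the map are the `x`
with `c_x > 0`.) -/
@[ext]
structure EvenConfig {X : Type*} (G : SimpleGraph X) where
  /-- half the number of incident edges, `c_x` -/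
  c : X → ℕ
  /-- the half-edge to which a half-edge is coupled -/
  couple : (Σ x, Fin (2 * c x)) → (Σ x, Fin (2 * c x))
  couple_couple : ∀ h, couple (couple h) = h
  adj : ∀ h, G.Adj h.1 (couple h).1

instance {X : Type*} (G : SimpleGraph X) : MeasurableSpace (EvenConfig G) := ⊤

/-- The number of half-edges at `x` that are coupled to a half-edge at `y`, that is, the number
of edges of the map between `x` and `y`. -/
def EvenConfig.mult {X : Type*} [DecidableEq X] {G : SimpleGraph X} (c : EvenConfig G)
    (x y : X) : ℕ :=
  Fintype.card {i : Fin (2 * c.c x) // (c.couple ⟨x, i⟩).1 = y}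

theorem EvenConfig.mult_le {X : Type*} [DecidableEq X] {G : SimpleGraph X} (c : EvenConfig G)
    (x y : X) : c.mult x y ≤ c.mult y x := by
  have key : ∀ i : {i : Fin (2 * c.c x) // (c.couple ⟨x, i⟩).1 = y},
      ∃ j : {j : Fin (2 * c.c y) // (c.couple ⟨y, j⟩).1 = x},
        c.couple ⟨x, i.1⟩ = ⟨y, j.1⟩ := by
    rintro ⟨i, hi⟩
    have h2 := c.couple_couple ⟨x, i⟩
    revert h2
    dsimp only
    generalize c.couple ⟨x, i⟩ = q at hi
    obtain ⟨y', j⟩ := q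
    subst hi
    intro h2
    exact ⟨⟨j, by rw [h2]⟩, rfl⟩
  choose f hf using key
  refine Fintype.card_le_of_injective f ?_
  intro i i' h
  have h1 : c.couple ⟨x, i.1⟩ = c.couple ⟨x, i'.1⟩ := by rw [hf, hf, h]
  have h2 := congrArg c.couple h1
  rw [c.couple_couple, c.couple_couple] at h2
  exact Subtype.ext (eq_of_heq (Sigma.mk.inj h2).2)

theorem EvenConfig.mult_comm {X : Type*} [DecidableEq X] {G : SimpleGraph X} (c : EvenConfig G)
    (x y : X) : c.mult x y = c.mult y x :=
  le_antisymm (c.mult_le x y) (c.mult_le y x)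

/-- The number `c_{ {x,y} }` of edges of the map which are copies of the edge `{x,y}`. -/
def EvenConfig.edgeMult {X : Type*} [DecidableEq X] {G : SimpleGraph X} (c : EvenConfig G)
    (e : Sym2 X) : ℕ :=
  Sym2.lift ⟨fun x y => c.mult x y, fun x y => c.mult_comm x y⟩ e

/-- The weight `√(P_{x,y} P_{y,x})` of the non oriented edge `{x,y}`. -/
def edgeWeight {X : Type*} (P : Matrix X X ℝ) (e : Sym2 X) : ℝ :=
  Sym2.lift ⟨fun x y => Real.sqrt (P x y * P y x), fun _ _ => congrArg Real.sqrt (mul_comm _ _)⟩ e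

/-- `Q(c) = √det(I - P) ∏_x 1 / (2^{c_x} c_x!) ∏_{ {x,y} ∈ E } √(P_{x,y} P_{y,x}) ^ c_{ {x,y} }`. -/
def evenWeight {X : Type*} [Fintype X] [DecidableEq X] (G : SimpleGraph X) [DecidableRel G.Adj]
    (P : Matrix X X ℝ) (c : EvenConfig G) : ℝ :=
  Real.sqrt (1 - P).det * (∏ x, 1 / (2 ^ c.c x * (Nat.factorial (c.c x) : ℝ))) *
    ∏ e ∈ G.edgeFinset, edgeWeight P e ^ c.edgeMult e

/-- The measure `Q^{ev}` on the (countable) set of even configurations. -/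
def evenMeasure {X : Type*} [Fintype X] [DecidableEq X] (G : SimpleGraph X) [DecidableRel G.Adj]
    (P : Matrix X X ℝ) : Measure (EvenConfig G) :=
  Measure.sum fun c => ENNReal.ofReal (evenWeight G P c) • Measure.dirac c

/-- The even network `(c_e)_{e ∈ E}` defined by a configuration. -/
def EvenConfig.network {X : Type*} [DecidableEq X] {G : SimpleGraph X} (c : EvenConfig G) :
    G.edgeSet → ℕ :=
  fun e => c.edgeMult e.1

end LoopNetwork

end

/-! Both laws are compared through their Laplace transforms at integer points `k`. The functions
`e^{-x_e}` separate the points of the compact space `[0,∞]^E`, so by Stone-Weierstrass these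
transforms determine a finite measure (`ext_of_lintegral_expNeg`). A factor `e^{-k_e}` for each
crossing of `e`, or for each copy of `e` in a map, amounts to replacing `P` by the thinned matrix
`P_k` with entries `P_{x,y} e^{-k_{x,y}}`. Both transforms turn out to be `√(det(I - P) / det(I -
P_k))`.

Loops: the Laplace functional of a Poisson process (`lintegral_expNeg_lintegral`) gives `exp(-½ ∫ (1
- e^{-∑ k_e N_e}) dμ)`. Once the holding times are integrated out, a based cycle with `n` jumps has
mass `(1/n) ∏ P`. The integral is therefore `∑_n (tr P^n - tr P_k^n)/n`, a difference of two
logarithms of determinants.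

Maps: let `M` be the symmetric matrix of the thinned edge weights. Then `exp(½ φᵀMφ)` is the
exponential generating function, in the degrees `d`, of the weighted pairings of `d_x` half-edges at
each `x` (`hasSum_degreeSum`). Under a standard Gaussian `φ` the odd moments vanish and the even
moments `(2c)!/(2^c c!)` turn `1/(2c)!` into `1/(2^c c!)`, so the total weight is `det(I -
M)^{-1/2}` (`hasSum_even_degreeSum`).

Finally `M` is conjugate to `P_k` by the diagonal matrix of `√λ_x`. Positivity of the energy makes
`M` a strict contraction, which justifies the logarithmic series, the Gaussian integral and the
exchange of sum and integral. The case `k = 0` gives total mass one. -/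

noncomputable section

namespace LoopNetwork

/-! ### Laplace functionals of Poisson processes -/

section Laplace

/-! ### The function `x ↦ e^{-x}` on `[0, ∞]` -/

/-- The function `x ↦ e^{-x}` on `[0, ∞]`, with `e^{-∞} = 0`. -/
def expNeg (x : ℝ≥0∞) : ℝ≥0∞ := EReal.exp (-(x : EReal))

@[simp] theorem expNeg_zero : expNeg 0 = 1 := by simp [expNeg]

@[simp] theorem expNeg_top : expNeg ∞ = 0 := by simp [expNeg]

theorem expNeg_ofReal {x : ℝ} (hx : 0 ≤ x) :
    expNeg (ENNReal.ofReal x) = ENNReal.ofReal (Real.exp (-x)) := by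
  rw [expNeg, EReal.coe_ennreal_ofReal, max_eq_left hx, ← EReal.coe_neg, EReal.exp_coe]

theorem expNeg_natCast (n : ℕ) : expNeg n = ENNReal.ofReal (Real.exp (-n)) := by
  rw [← ENNReal.ofReal_natCast, expNeg_ofReal n.cast_nonneg]

theorem expNeg_add (x y : ℝ≥0∞) : expNeg (x + y) = expNeg x * expNeg y := by
  rw [expNeg, expNeg, expNeg, ← EReal.exp_add, EReal.coe_ennreal_add,
    EReal.neg_add (Or.inl (EReal.coe_ennreal_ne_bot x)) (Or.inr (EReal.coe_ennreal_ne_bot y)),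
    sub_eq_add_neg]

theorem expNeg_le_one (x : ℝ≥0∞) : expNeg x ≤ 1 := by
  rw [expNeg, EReal.exp_le_one_iff, EReal.neg_le, neg_zero]
  exact EReal.coe_ennreal_nonneg x

theorem expNeg_ne_top (x : ℝ≥0∞) : expNeg x ≠ ∞ :=
  ne_top_of_le_ne_top ENNReal.one_ne_top (expNeg_le_one x)

theorem continuous_expNeg : Continuous expNeg :=
  ENNReal.continuous_exp.comp (continuous_neg.comp continuous_coe_ennreal_ereal)

theorem measurable_expNeg : Measurable expNeg := continuous_expNeg.measurable

theorem expNeg_strictAnti : StrictAnti expNeg := fun _ _ h =>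
  EReal.exp_strictMono (EReal.neg_lt_neg_iff.2 (EReal.coe_ennreal_lt_coe_ennreal_iff.2 h))

theorem expNeg_sum {ι : Type*} (s : Finset ι) (f : ι → ℝ≥0∞) :
    expNeg (∑ i ∈ s, f i) = ∏ i ∈ s, expNeg (f i) := by
  classical
  induction s using Finset.induction_on with
  | empty => simp
  | insert a s ha ih => rw [Finset.sum_insert ha, Finset.prod_insert ha, expNeg_add, ih]

theorem expNeg_nat_mul (n : ℕ) (x : ℝ≥0∞) : expNeg (n * x) = expNeg x ^ n := by
  have h := expNeg_sum (Finset.range n) (fun _ => x)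
  simpa using h

/-! ### The Laplace functional of a Poisson process -/

/-- This is the Poisson generating function `E z^n = e^{-(1-z)a}` at `z = e^{-v}`. The value `v =
∞`, that is `z = 0`, is included. -/
theorem lintegral_expNeg_poissonMeasure (a : ℝ≥0) (v : ℝ≥0∞) :
    ∫⁻ n : ℕ, expNeg (v * n) ∂(poissonMeasure a) = expNeg ((1 - expNeg v) * a) := by
  obtain ⟨z, hz0, hz⟩ : ∃ z : ℝ, 0 ≤ z ∧ expNeg v = ENNReal.ofReal z :=
    ⟨(expNeg v).toReal, ENNReal.toReal_nonneg, (ENNReal.ofReal_toReal (expNeg_ne_top v)).symm⟩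
  have hz1 : z ≤ 1 := by
    have h := expNeg_le_one v
    rwa [hz, ENNReal.ofReal_le_one] at h
  have hsum : HasSum (fun n : ℕ => Real.exp (-a) * (a : ℝ) ^ n / n.factorial * z ^ n)
      (Real.exp (-((1 - z) * a))) := by
    convert! (NormedSpace.expSeries_div_hasSum_exp ((a : ℝ) * z)).mul_left (Real.exp (-a)) using 1
    · ext n; rw [mul_pow]; ring
    · rw [← Real.exp_eq_exp_ℝ, ← Real.exp_add]; congr 1; ring
  rw [poissonMeasure, lintegral_sum_measure]
  simp_rw [lintegral_smul_measure, lintegral_dirac, mul_comm v, expNeg_nat_mul, hz, smul_eq_mul]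
  rw [← ENNReal.ofReal_one, ← ENNReal.ofReal_sub 1 hz0, ← ENNReal.ofReal_coe_nnreal,
    ← ENNReal.ofReal_mul (by linarith), expNeg_ofReal (by have := a.2; nlinarith), ← hsum.tsum_eq,
    ENNReal.ofReal_tsum_of_nonneg (fun n => by positivity) hsum.summable]
  refine tsum_congr fun n => ?_
  rw [← ENNReal.ofReal_pow hz0, ← ENNReal.ofReal_mul (by positivity)]

variable {Ω S : Type*} [MeasurableSpace Ω] [MeasurableSpace S]

theorem IsPoissonProcess.lintegral_expNeg_mul_apply {Pr : Measure Ω} [IsProbabilityMeasure Pr]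
    {L : Ω → Measure S} {ν : Measure S} (hL : IsPoissonProcess Pr L ν) {A : Set S}
    (hA : MeasurableSet A) (v : ℝ≥0∞) :
    ∫⁻ ω, expNeg (v * L ω A) ∂Pr = expNeg ((1 - expNeg v) * ν A) := by
  by_cases hν : ν A = ∞
  · rw [lintegral_congr_ae ((hL.law_top A hA hν).mono fun ω h => by rw [h])]
    -- Since `0 * ∞ = 0`, both sides are `1` when `v = 0`; for `v > 0` the infinite count makes both
    -- sides `0`.
    rcases eq_or_ne v 0 with rfl | hv
    · simp
    · have h1 : expNeg v < 1 := by
        rw [← expNeg_zero]; exact expNeg_strictAnti (pos_iff_ne_zero.2 hv)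
      rw [hν, ENNReal.mul_top hv, ENNReal.mul_top (tsub_pos_of_lt h1).ne']
      simp
  · have hm : Measurable fun y : ℝ≥0∞ => expNeg (v * y) :=
      measurable_expNeg.comp (measurable_const.mul measurable_id)
    rw [← lintegral_map hm (hL.measurable A hA), hL.law A hA hν,
      lintegral_map hm (by fun_prop), lintegral_expNeg_poissonMeasure, ENNReal.coe_toNNReal hν]

/-- The fibres of `f` are disjoint, so their counts are independent and the expectation of the
product of exponentials splits over the values of `f`. -/
theorem IsPoissonProcess.lintegral_expNeg_simpleFunc {Pr : Measure Ω} [IsProbabilityMeasure Pr]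
    {L : Ω → Measure S} {ν : Measure S} (hL : IsPoissonProcess Pr L ν) (f : SimpleFunc S ℝ≥0∞) :
    ∫⁻ ω, expNeg (∫⁻ l, f l ∂(L ω)) ∂Pr = expNeg (∫⁻ l, (1 - expNeg (f l)) ∂ν) := by
  have h1 : ∀ ω, expNeg (∫⁻ l, f l ∂(L ω)) = ∏ i : Fin f.range.card,
      expNeg (((f.range.equivFin.symm i : f.range) : ℝ≥0∞) *
        L ω (f ⁻¹' {((f.range.equivFin.symm i : f.range) : ℝ≥0∞)})) := by
    intro ω
    rw [SimpleFunc.lintegral_eq_lintegral, SimpleFunc.lintegral, expNeg_sum,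
      ← Finset.prod_coe_sort f.range, ← Equiv.prod_comp f.range.equivFin.symm]
  have hA : ∀ v, MeasurableSet (f ⁻¹' {v}) := fun v => f.measurableSet_fiber v
  have hind := hL.indep f.range.card
    (fun i => f ⁻¹' {((f.range.equivFin.symm i : f.range) : ℝ≥0∞)}) (fun i => hA _) (by
      intro i j hij
      refine Disjoint.preimage _ (Set.disjoint_singleton.2 fun h => hij ?_)
      exact f.range.equivFin.symm.injective (Subtype.ext h))
  have hm : ∀ v : ℝ≥0∞, Measurable fun y : ℝ≥0∞ => expNeg (v * y) := fun v =>
    measurable_expNeg.comp (measurable_const.mul measurable_id)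
  have hind2 := hind.comp
    (fun i y => expNeg (((f.range.equivFin.symm i : f.range) : ℝ≥0∞) * y)) (fun i => hm _)
  simp_rw [h1]
  have hprod := lintegral_prod_eq_prod_lintegral_of_indepFun Finset.univ _ hind2
    (fun i => (hm _).comp (hL.measurable _ (hA _)))
  simp only [Function.comp_def] at hprod
  rw [hprod]
  simp_rw [hL.lintegral_expNeg_mul_apply (hA _)]
  rw [← expNeg_sum]
  congr 1
  have h2 : ∀ l, 1 - expNeg (f l) = (f.map fun v => 1 - expNeg v) l := fun l => rfl
  simp_rw [h2]
  rw [SimpleFunc.lintegral_eq_lintegral, SimpleFunc.map_lintegral, ← Finset.sum_coe_sort f.range,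
    ← Equiv.sum_comp f.range.equivFin.symm]

/-- The Laplace functional of a Poisson process. -/
theorem IsPoissonProcess.lintegral_expNeg_lintegral {Pr : Measure Ω} [IsProbabilityMeasure Pr]
    {L : Ω → Measure S} {ν : Measure S} (hL : IsPoissonProcess Pr L ν) {f : S → ℝ≥0∞}
    (hf : Measurable f) :
    ∫⁻ ω, expNeg (∫⁻ l, f l ∂(L ω)) ∂Pr = expNeg (∫⁻ l, (1 - expNeg (f l)) ∂ν) := by
  -- Simple functions increase to `f`: monotone convergence handles both inner integrals, and the
  -- bound `e^{-x} ≤ 1` the expectation.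
  have happ : ∀ m : Measure S, Filter.Tendsto (fun n => ∫⁻ l, SimpleFunc.eapprox f n l ∂m)
      Filter.atTop (nhds (∫⁻ l, f l ∂m)) := fun m =>
    lintegral_tendsto_of_tendsto_of_monotone
      (fun n => (SimpleFunc.eapprox f n).measurable.aemeasurable)
      (.of_forall fun l _ _ h => SimpleFunc.monotone_eapprox f h l)
      (.of_forall fun l => SimpleFunc.tendsto_eapprox hf l)
  have hLm : Measurable L := Measure.measurable_of_measurable_coe L hL.measurable
  have h1 : Filter.Tendsto
      (fun n => ∫⁻ ω, expNeg (∫⁻ l, SimpleFunc.eapprox f n l ∂(L ω)) ∂Pr) Filter.atTop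
      (nhds (∫⁻ ω, expNeg (∫⁻ l, f l ∂(L ω)) ∂Pr)) := by
    refine tendsto_lintegral_of_dominated_convergence (fun _ => 1) (fun n => ?_)
      (fun n => .of_forall fun ω => expNeg_le_one _) (by simp)
      (.of_forall fun ω => (continuous_expNeg.tendsto _).comp (happ (L ω)))
    exact measurable_expNeg.comp
      ((Measure.measurable_lintegral (SimpleFunc.eapprox f n).measurable).comp hLm)
  have hc : Continuous fun x => 1 - expNeg x :=
    (ENNReal.continuous_sub_left ENNReal.one_ne_top).comp continuous_expNeg
  have h2 : Filter.Tendsto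
      (fun n => expNeg (∫⁻ l, (1 - expNeg (SimpleFunc.eapprox f n l)) ∂ν)) Filter.atTop
      (nhds (expNeg (∫⁻ l, (1 - expNeg (f l)) ∂ν))) := by
    refine (continuous_expNeg.tendsto _).comp (lintegral_tendsto_of_tendsto_of_monotone
      (fun n => (hc.measurable.comp (SimpleFunc.eapprox f n).measurable).aemeasurable)
      (.of_forall fun l _ _ h => tsub_le_tsub_left
        (expNeg_strictAnti.antitone (SimpleFunc.monotone_eapprox f h l)) _)
      (.of_forall fun l => (hc.tendsto _).comp (SimpleFunc.tendsto_eapprox hf l)))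
  simp_rw [hL.lintegral_expNeg_simpleFunc] at h1
  exact tendsto_nhds_unique h1 h2

end Laplace

section Uniqueness

/-! ### Measures on `[0, ∞]^ι` are determined by their Laplace transform -/

theorem integral_toReal_expNeg_sum {ι : Type*} [Fintype ι] (α : Measure (ι → ℝ≥0∞)) (k : ι → ℕ) :
    ∫ x, ∏ i, (expNeg (x i)).toReal ^ k i ∂α =
      (∫⁻ x, expNeg (∑ i, k i * x i) ∂α).toReal := by
  have hm : Measurable fun x : ι → ℝ≥0∞ => expNeg (∑ i, k i * x i) :=
    measurable_expNeg.comp (by fun_prop)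
  rw [← integral_toReal hm.aemeasurable (.of_forall fun x => (expNeg_ne_top _).lt_top)]
  simp_rw [expNeg_sum, expNeg_nat_mul, ENNReal.toReal_prod, ENNReal.toReal_pow]

/-- Polynomials in the `e^{-x_i}` form a point-separating algebra of bounded continuous functions,
and the integral of a monomial is a Laplace transform at an integer point. Infinite coordinates
cause no trouble because `e^{-∞} = 0` and `0 * ∞ = 0` matches `0 ^ 0 = 1`. -/
theorem ext_of_lintegral_expNeg {ι : Type*} [Fintype ι] {α β : Measure (ι → ℝ≥0∞)}
    [IsFiniteMeasure α] [IsFiniteMeasure β]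
    (h : ∀ k : ι → ℕ, ∫⁻ x, expNeg (∑ i, k i * x i) ∂α = ∫⁻ x, expNeg (∑ i, k i * x i) ∂β) :
    α = β := by
  have hcont : ∀ i, Continuous fun x : ι → ℝ≥0∞ => (expNeg (x i)).toReal := fun i =>
    ENNReal.continuousOn_toReal.comp_continuous (continuous_expNeg.comp (continuous_apply i))
      fun x => expNeg_ne_top _
  let coord : ι → BoundedContinuousFunction (ι → ℝ≥0∞) ℝ := fun i =>
    BoundedContinuousFunction.mkOfCompact ⟨_, hcont i⟩
  let A : StarSubalgebra ℝ (BoundedContinuousFunction (ι → ℝ≥0∞) ℝ) :=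
    { (MvPolynomial.aeval coord : MvPolynomial ι ℝ →ₐ[ℝ] _).range with
      star_mem' := fun {a} ha => by rwa [show star a = a by ext; simp] }
  refine ext_of_forall_mem_subalgebra_integral_eq_of_polish (𝕜 := ℝ) (A := A) ?_ ?_
  · intro x y hxy
    obtain ⟨i, hi⟩ := Function.ne_iff.1 hxy
    refine ⟨fun z => (expNeg (z i)).toReal, ⟨⟨_, hcont i⟩, ?_, rfl⟩, fun h => hi ?_⟩
    · exact ⟨coord i, ⟨MvPolynomial.X i, by simp⟩, rfl⟩
    · exact expNeg_strictAnti.injective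
        ((ENNReal.toReal_eq_toReal_iff' (expNeg_ne_top _) (expNeg_ne_top _)).1 h)
  · rintro _ ⟨p, rfl⟩
    simp only [AlgHom.coe_toRingHom, AlgHom.toRingHom_eq_coe]
    induction p using MvPolynomial.induction_on' with
    | monomial k c =>
      have hk : ∀ x, (MvPolynomial.aeval coord (MvPolynomial.monomial k c)) x =
          c * ∏ i, (expNeg (x i)).toReal ^ k i := by
        intro x
        rw [MvPolynomial.aeval_monomial, Finsupp.prod_fintype _ _ (by simp)]
        simp only [coord, BoundedContinuousFunction.coe_mul, Pi.mul_apply,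
          BoundedContinuousFunction.coe_prod, Finset.prod_apply, BoundedContinuousFunction.coe_pow,
          Pi.pow_apply]
        rfl
      simp_rw [hk, integral_const_mul, integral_toReal_expNeg_sum, h]
    | add p q hp hq =>
      simp_rw [map_add, BoundedContinuousFunction.coe_add, Pi.add_apply]
      rw [integral_add (BoundedContinuousFunction.integrable _ _)
        (BoundedContinuousFunction.integrable _ _), integral_add
        (BoundedContinuousFunction.integrable _ _) (BoundedContinuousFunction.integrable _ _),
        hp, hq]

end Uniqueness

/-! ### Integration against the loop measure -/

section LoopIntegral

/-! ### The total mass of the holding times -/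

theorem lintegral_exp_neg_mul_sum {n : ℕ} {u : ℝ} (hu : 0 < u) :
    ∫⁻ τ : Fin n → ℝ in {τ | ∀ i, 0 < τ i}, ENNReal.ofReal (Real.exp (-u * ∑ i, τ i)) =
      ENNReal.ofReal ((1 / u) ^ n) := by
  have hset : {τ : Fin n → ℝ | ∀ i, 0 < τ i} = Set.univ.pi fun _ => Set.Ioi 0 := by
    ext τ; simp
  have hint : IntegrableOn (fun x : ℝ => Real.exp (-u * x)) (Set.Ioi 0) :=
    integrableOn_exp_mul_Ioi (by linarith) 0
  have hprod : ∀ τ : Fin n → ℝ, Real.exp (-u * ∑ i, τ i) = ∏ i, Real.exp (-u * τ i) := by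
    intro τ; rw [Finset.mul_sum, Real.exp_sum]
  rw [hset, volume_pi, Measure.restrict_pi_pi]
  simp_rw [hprod]
  rw [← ofReal_integral_eq_lintegral_ofReal]
  · rw [integral_fintype_prod_eq_pow (fun x : ℝ => Real.exp (-u * x)),
      integral_exp_mul_Ioi (by linarith)]
    simp
  · exact Integrable.fintype_prod (f := fun _ x => Real.exp (-u * x)) fun _ => hint
  · exact .of_forall fun τ => Finset.prod_nonneg fun i _ => (Real.exp_pos _).le

theorem lintegral_exp_neg_mul_Ioi_one {S : ℝ} (hS : 0 < S) :
    ∫⁻ u in Set.Ioi (1 : ℝ), ENNReal.ofReal (Real.exp (-u * S)) =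
      ENNReal.ofReal (Real.exp (-S) / S) := by
  have h : ∀ u : ℝ, -u * S = -S * u := fun u => by ring
  simp_rw [h]
  rw [← ofReal_integral_eq_lintegral_ofReal (integrableOn_exp_mul_Ioi (by linarith) 1)
    (.of_forall fun u => (Real.exp_pos _).le), integral_exp_mul_Ioi (by linarith)]
  congr 1
  rw [mul_one, neg_div_neg_eq]

/-- The total mass of the holding times of a based loop with `m + 1` jumps. -/
theorem lintegral_holding (m : ℕ) :
    ∫⁻ τ : Fin (m + 2) → ℝ in {τ | ∀ i, 0 < τ i},
      ENNReal.ofReal (Real.exp (-∑ i, τ i) / ∑ i, τ i) = ENNReal.ofReal (1 / (m + 1)) := by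
  have hmeas : MeasurableSet {τ : Fin (m + 2) → ℝ | ∀ i, 0 < τ i} := by
    simp_rw [Set.ofPred_forall]
    exact MeasurableSet.iInter fun i => measurableSet_lt measurable_const (measurable_pi_apply i)
  -- With `S` the total duration, `e^{-S}/S = ∫_1^∞ e^{-uS} du`. After Fubini the `m + 2` holding
  -- times contribute `u^{-(m+2)}`, whose integral over `u > 1` is `1/(m+1)`. There is one holding
  -- time more than jumps because the stay at the base site is cut in two.
  have h1 : ∀ τ ∈ {τ : Fin (m + 2) → ℝ | ∀ i, 0 < τ i},
      ENNReal.ofReal (Real.exp (-∑ i, τ i) / ∑ i, τ i) =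
        ∫⁻ u in Set.Ioi (1 : ℝ), ENNReal.ofReal (Real.exp (-u * ∑ i, τ i)) := fun τ hτ =>
    (lintegral_exp_neg_mul_Ioi_one (Finset.sum_pos (fun i _ => hτ i) Finset.univ_nonempty)).symm
  have h2 : ∀ u ∈ Set.Ioi (1 : ℝ),
      ∫⁻ τ : Fin (m + 2) → ℝ in {τ | ∀ i, 0 < τ i},
        ENNReal.ofReal (Real.exp (-u * ∑ i, τ i)) = ENNReal.ofReal (u ^ (-(m + 2) : ℝ)) := by
    intro u hu
    have hu0 : (0 : ℝ) < u := zero_lt_one.trans hu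
    rw [lintegral_exp_neg_mul_sum hu0, one_div, inv_pow, Real.rpow_neg hu0.le]
    norm_cast
  rw [setLIntegral_congr_fun hmeas h1, lintegral_lintegral_swap (by fun_prop),
    setLIntegral_congr_fun measurableSet_Ioi h2, ← ofReal_integral_eq_lintegral_ofReal
      (integrableOn_Ioi_rpow_of_lt (by have := m.cast_nonneg (α := ℝ); linarith) one_pos),
    integral_Ioi_rpow_of_lt (by have := m.cast_nonneg (α := ℝ); linarith) one_pos]
  · congr 1
    rw [Real.one_rpow, neg_div, ← div_neg]
    congr 1
    ring
  · exact (ae_restrict_iff' measurableSet_Ioi).2 (.of_forall fun u hu =>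
      Real.rpow_nonneg (zero_le_one.trans (le_of_lt hu)) _)

/-! ### Sums over itineraries -/

variable {X : Type*}

theorem lintegral_basedLoopMeasure (P : Matrix X X ℝ) {F : BasedLoop X → ℝ≥0∞}
    (hF : Measurable F) (h : Itinerary X → ℝ≥0∞) (hFh : ∀ s τ, F ⟨s, τ⟩ = h s) :
    ∫⁻ b, F b ∂(basedLoopMeasure P) =
      ∑' s : Itinerary X, ENNReal.ofReal (∏ i : Fin s.n, P (s.site i.castSucc) (s.site i.succ)) *
        (h s * ∫⁻ τ : Fin (s.n + 1) → ℝ in {τ | ∀ i, 0 < τ i},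
          ENNReal.ofReal (Real.exp (-∑ i, τ i) / ∑ i, τ i)) := by
  rw [basedLoopMeasure, lintegral_sum_measure]
  refine tsum_congr fun s => ?_
  have hs : Measurable (fun τ => (⟨s, τ⟩ : BasedLoop X)) :=
    fun _ h => MeasurableSpace.measurableSet_iInf.1 h s
  rw [lintegral_smul_measure, lintegral_map hF hs, smul_eq_mul]
  simp_rw [hFh]
  rw [lintegral_const, withDensity_apply _ MeasurableSet.univ, Measure.restrict_univ]

/-- The itinerary that runs through a cyclic sequence of sites. -/
def Itinerary.ofCycle (p : Σ m : ℕ, Fin (m + 1) → X) : Itinerary X where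
  n := p.1 + 1
  site := Fin.snoc (α := fun _ => X) p.2 (p.2 0)
  closed := by
    rw [Fin.snoc_last, show (0 : Fin (p.1 + 1 + 1)) = Fin.castSucc 0 from rfl, Fin.snoc_castSucc]

theorem Itinerary.ofCycle_injective : Function.Injective (Itinerary.ofCycle (X := X)) := by
  rintro ⟨m, ξ⟩ ⟨m', ξ'⟩ h
  obtain rfl : m = m' := Nat.succ_injective (congrArg Itinerary.n h)
  have h2 : Fin.snoc (α := fun _ => X) ξ (ξ 0) = Fin.snoc (α := fun _ => X) ξ' (ξ' 0) := by
    simpa [Itinerary.ofCycle] using h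
  congr 1
  ext i
  have h3 := congrFun h2 i.castSucc
  rwa [Fin.snoc_castSucc, Fin.snoc_castSucc] at h3

theorem Itinerary.exists_ofCycle {s : Itinerary X} (hs : s.n ≠ 0) :
    ∃ p, Itinerary.ofCycle p = s := by
  obtain ⟨n, site, hc⟩ := s
  obtain ⟨m, rfl⟩ := Nat.exists_eq_succ_of_ne_zero hs
  refine ⟨⟨m, fun i => site i.castSucc⟩, ?_⟩
  simp only [Itinerary.ofCycle, Nat.succ_eq_add_one, Itinerary.mk.injEq, heq_eq_eq, true_and]
  ext i
  refine Fin.lastCases ?_ (fun j => ?_) i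
  · rw [Fin.snoc_last]; exact hc.symm
  · rw [Fin.snoc_castSucc]

theorem Itinerary.ofCycle_site_succ (m : ℕ) (ξ : Fin (m + 1) → X) (i : Fin (m + 1)) :
    (Itinerary.ofCycle ⟨m, ξ⟩).site i.succ = ξ (i + 1) := by
  change Fin.snoc (α := fun _ => X) ξ (ξ 0) i.succ = ξ (i + 1)
  refine Fin.lastCases ?_ (fun j => ?_) i
  · rw [Fin.succ_last, Fin.snoc_last, Fin.last_add_one]
  · rw [← Fin.castSucc_succ, Fin.snoc_castSucc, Fin.coeSucc_eq_succ]

theorem Itinerary.ofCycle_site_castSucc (m : ℕ) (ξ : Fin (m + 1) → X) (i : Fin (m + 1)) :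
    (Itinerary.ofCycle ⟨m, ξ⟩).site i.castSucc = ξ i :=
  Fin.snoc_castSucc (α := fun _ => X) (ξ 0) ξ i

/-- The integral against the loop measure of a function that depends only on the sites, and
vanishes on loops without jumps. -/
theorem lintegral_loopMeasure [Fintype X] (P : Matrix X X ℝ) {F : Loop X → ℝ≥0∞}
    (hF : Measurable F) (h : (Σ m : ℕ, Fin (m + 1) → X) → ℝ≥0∞)
    (hFh : ∀ p T, F (Quotient.mk (rotationSetoid X) ⟨p, T⟩) = h p) (h0 : ∀ ξ, h ⟨0, ξ⟩ = 0) :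
    ∫⁻ l, F l ∂(loopMeasure P) =
      ∑' m : ℕ, ∑ ξ : Fin (m + 1) → X, ENNReal.ofReal (∏ i, P (ξ i) (ξ (i + 1))) *
        (h ⟨m, ξ⟩ * ENNReal.ofReal (1 / (m + 1))) := by
  -- Itineraries without jumps have infinite mass, as `e^{-τ}/τ` is not integrable at `0`; the value
  -- `0` of the integrand removes them through `0 * ∞ = 0`.
  let hI : Itinerary X → ℝ≥0∞
    | ⟨0, _, _⟩ => 0
    | ⟨m + 1, ξ, _⟩ => h ⟨m, fun i => ξ i.castSucc⟩
  rw [loopMeasure, lintegral_map hF BasedLoop.measurable_toLoop,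
    lintegral_basedLoopMeasure P (F := fun b => F b.toLoop)
      (hF.comp BasedLoop.measurable_toLoop) hI]
  · rw [← Itinerary.ofCycle_injective.tsum_eq, ENNReal.tsum_sigma']
    · refine tsum_congr fun m => ?_
      rw [tsum_fintype]
      refine Finset.sum_congr rfl fun ξ _ => ?_
      refine congrArg₂ (· * ·) ?_ (congrArg₂ (· * ·) ?_ (lintegral_holding m))
      · refine congrArg ENNReal.ofReal (Finset.prod_congr rfl fun i _ => ?_)
        exact congrArg₂ P (Itinerary.ofCycle_site_castSucc m ξ i)
          (Itinerary.ofCycle_site_succ m ξ i)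
      · change h ⟨m, fun i => (Itinerary.ofCycle ⟨m, ξ⟩).site i.castSucc⟩ = _
        simp_rw [Itinerary.ofCycle_site_castSucc]
    · intro s hs
      refine Itinerary.exists_ofCycle fun hn => hs ?_
      obtain ⟨n, ξ, hξ⟩ := s
      obtain rfl : n = 0 := hn
      change _ * (0 * _) = _
      rw [zero_mul, mul_zero]
  · rintro ⟨_ | m, ξ, hξ⟩ τ
    · exact (hFh _ _).trans (h0 _)
    · exact hFh _ _

end LoopIntegral

/-! ### Traces, and the loop measure of crossing numbers -/

section LoopTrace

/-! ### Traces of powers as sums over cyclic sequences -/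

section Trace

variable {X R : Type*} [Fintype X] [DecidableEq X] [CommSemiring R]

/-- The terminal function `φ` makes the induction on the length go through, and later closes the
path into a cycle. -/
theorem sum_prod_path (M : Matrix X X R) (n : ℕ) (φ : X → R) (x : X) :
    ∑ ξ : Fin n → X, (∏ i : Fin n, M (Fin.cons (α := fun _ => X) x ξ i.castSucc) (ξ i)) *
        φ (Fin.cons (α := fun _ => X) x ξ (Fin.last n)) = (M ^ n).mulVec φ x := by
  induction n generalizing x with
  | zero => simp
  | succ n ih =>
    rw [pow_succ', ← Matrix.mulVec_mulVec, Matrix.mulVec, dotProduct,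
      ← (Fin.consEquiv fun _ => X).sum_comp, Fintype.sum_prod_type]
    refine Finset.sum_congr rfl fun y _ => ?_
    rw [← ih y, Finset.mul_sum]
    refine Finset.sum_congr rfl fun ξ _ => ?_
    rw [Fin.prod_univ_succ, ← Fin.succ_last, ← mul_assoc]
    simp only [Fin.consEquiv_apply, Fin.castSucc_zero, Fin.cons_zero, Fin.castSucc_succ,
      Fin.cons_succ]

theorem sum_prod_cycle (M : Matrix X X R) (m : ℕ) :
    ∑ ξ : Fin (m + 1) → X, ∏ i, M (ξ i) (ξ (i + 1)) = (M ^ (m + 1)).trace := by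
  rw [← (Fin.consEquiv fun _ => X).sum_comp, Fintype.sum_prod_type, pow_succ, Matrix.trace]
  refine Finset.sum_congr rfl fun x _ => ?_
  rw [Matrix.diag_apply, Matrix.mul_apply]
  -- The closing jump back to `x` plays the role of the terminal function.
  refine Eq.trans ?_ (sum_prod_path M m (fun y => M y x) x)
  refine Finset.sum_congr rfl fun ξ _ => ?_
  rw [Fin.prod_univ_castSucc, Fin.last_add_one]
  simp only [Fin.consEquiv_apply, Fin.coeSucc_eq_succ, Fin.cons_succ, Fin.cons_zero]

end Trace

/-! ### The number of crossings of an edge by a loop -/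

section Thinned

variable {X : Type*}

open Classical in
/-- Extension by `0` of a function on the edges. -/
def edgeExt {G : SimpleGraph X} (k : G.edgeSet → ℕ) (e : Sym2 X) : ℕ :=
  if h : e ∈ G.edgeSet then k ⟨e, h⟩ else 0

theorem edgeExt_coe {G : SimpleGraph X} (k : G.edgeSet → ℕ) (e : G.edgeSet) :
    edgeExt k e = k e := by
  simp [edgeExt]

/-- The matrix `P` with the entry `(x, y)` multiplied by `e^{-k_{ {x,y} }}`. -/
def thinned {G : SimpleGraph X} (k : G.edgeSet → ℕ) (P : Matrix X X ℝ) : Matrix X X ℝ :=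
  Matrix.of fun x y => P x y * Real.exp (-(edgeExt k s(x, y)))

theorem thinned_nonneg {G : SimpleGraph X} {P : Matrix X X ℝ} (hP : ∀ x y, 0 ≤ P x y)
    (k : G.edgeSet → ℕ) (x y : X) :
    0 ≤ thinned k P x y :=
  mul_nonneg (hP x y) (Real.exp_pos _).le

theorem thinned_le {G : SimpleGraph X} {P : Matrix X X ℝ} (hP : ∀ x y, 0 ≤ P x y)
    (k : G.edgeSet → ℕ) (x y : X) :
    thinned k P x y ≤ P x y :=
  mul_le_of_le_one_right (hP x y) (Real.exp_le_one_iff.2 (neg_nonpos.2 (Nat.cast_nonneg _)))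

end Thinned

variable {X : Type*} [DecidableEq X]

/-- The number of crossings of the non oriented edge `e`. -/
def Loop.edgeJumps (e : Sym2 X) (l : Loop X) : ℕ :=
  Sym2.lift ⟨fun x y => Loop.jumps x y l + Loop.jumps y x l, fun _ _ => add_comm _ _⟩ e

/-- On each piece with prescribed sites the count does not depend on the holding times. -/
theorem Loop.measurable_jumps (x y : X) : Measurable (Loop.jumps x y) := by
  refine measurable_from_quotient.2 fun A _ => MeasurableSpace.measurableSet_iInf.2 fun p => ?_
  change MeasurableSet {_T : Fin (p.1 + 1) → ℝ |
    Fintype.card {i : Fin (p.1 + 1) // x ≠ y ∧ p.2 i = x ∧ p.2 (i + 1) = y} ∈ A}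
  exact MeasurableSet.const _

theorem Loop.measurable_edgeJumps (e : Sym2 X) : Measurable (Loop.edgeJumps e) := by
  induction e with
  | _ x y => exact (Loop.measurable_jumps x y).add (Loop.measurable_jumps y x)

theorem Loop.edgeJumps_mk {e : Sym2 X} (he : ¬ e.IsDiag) {m : ℕ} (ξ : Fin (m + 1) → X)
    (T : Fin (m + 1) → ℝ) :
    Loop.edgeJumps e (Quotient.mk (rotationSetoid X) ⟨⟨m, ξ⟩, T⟩) =
      ∑ i, if s(ξ i, ξ (i + 1)) = e then 1 else 0 := by
  induction e with
  | _ x y =>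
    have hxy : x ≠ y := he
    change Fintype.card {i : Fin (m + 1) // x ≠ y ∧ ξ i = x ∧ ξ (i + 1) = y} +
      Fintype.card {i : Fin (m + 1) // y ≠ x ∧ ξ i = y ∧ ξ (i + 1) = x} = _
    rw [Fintype.card_subtype, Fintype.card_subtype, Finset.card_filter, Finset.card_filter,
      ← Finset.sum_add_distrib]
    refine Finset.sum_congr rfl fun i _ => ?_
    by_cases h1 : ξ i = x <;> by_cases h2 : ξ (i + 1) = y <;> by_cases h3 : ξ i = y <;>
      by_cases h4 : ξ (i + 1) = x <;> simp_all [hxy.symm]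

variable {G : SimpleGraph X} [Fintype G.edgeSet]

theorem sum_mul_edgeJumps_mk (k : G.edgeSet → ℕ) {m : ℕ} (ξ : Fin (m + 1) → X)
    (T : Fin (m + 1) → ℝ) :
    ∑ e : G.edgeSet, k e * Loop.edgeJumps (e : Sym2 X)
        (Quotient.mk (rotationSetoid X) ⟨⟨m, ξ⟩, T⟩) =
      ∑ i, edgeExt k s(ξ i, ξ (i + 1)) := by
  simp_rw [fun e : G.edgeSet => Loop.edgeJumps_mk (G.not_isDiag_of_mem_edgeSet e.2) ξ T,
    Finset.mul_sum]
  rw [Finset.sum_comm]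
  refine Finset.sum_congr rfl fun i _ => ?_
  by_cases h : s(ξ i, ξ (i + 1)) ∈ G.edgeSet
  · rw [Finset.sum_eq_single ⟨_, h⟩]
    · simp [edgeExt_coe k ⟨_, h⟩]
    · rintro b - hb
      rw [if_neg fun h' => hb (Subtype.ext h'.symm), mul_zero]
    · simp
  · rw [edgeExt, dif_neg h]
    refine Finset.sum_eq_zero fun e _ => ?_
    rw [if_neg fun h' : s(ξ i, ξ (i + 1)) = e => h (h'.symm ▸ e.2), mul_zero]

/-- The crossing factors multiply along a cycle, so they can be absorbed into the entries of `P`;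
the sum over cyclic sequences is then a trace, and `1/(m+1)` is the mass of the holding times. -/
theorem lintegral_one_sub_expNeg_loopMeasure [Fintype X] {P : Matrix X X ℝ} (hP : ∀ x y, 0 ≤ P x y) (k : G.edgeSet → ℕ) :
    ∫⁻ l, (1 - expNeg (∑ e : G.edgeSet, k e * (Loop.edgeJumps (e : Sym2 X) l : ℝ≥0∞)))
        ∂(loopMeasure P) =
      ∑' m : ℕ, ENNReal.ofReal
        (((P ^ (m + 1)).trace - ((thinned k P) ^ (m + 1)).trace) / (m + 1)) := by
  rw [lintegral_loopMeasure P
    (h := fun p => 1 - expNeg ((∑ i, edgeExt k s(p.2 i, p.2 (i + 1)) : ℕ) : ℝ≥0∞))]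
  · refine tsum_congr fun m => ?_
    rw [← sum_prod_cycle, ← sum_prod_cycle, ← Finset.sum_sub_distrib, Finset.sum_div,
      ENNReal.ofReal_sum_of_nonneg]
    · refine Finset.sum_congr rfl fun ξ _ => ?_
      rw [expNeg_natCast, ← ENNReal.ofReal_one, ← ENNReal.ofReal_sub _ (Real.exp_pos _).le,
        ← ENNReal.ofReal_mul (sub_nonneg.2 (Real.exp_le_one_iff.2 (neg_nonpos.2
          (Nat.cast_nonneg _)))), ← ENNReal.ofReal_mul (Finset.prod_nonneg fun i _ => hP _ _)]
      congr 1
      simp only [thinned, Matrix.of_apply]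
      rw [Finset.prod_mul_distrib, ← Real.exp_sum, Finset.sum_neg_distrib]
      push_cast
      ring
    · intro ξ _
      exact div_nonneg (sub_nonneg.2 (Finset.prod_le_prod (fun i _ => thinned_nonneg hP k _ _)
        fun i _ => thinned_le hP k _ _)) (by positivity)
  · refine (ENNReal.continuous_sub_left ENNReal.one_ne_top).measurable.comp
      (measurable_expNeg.comp (Finset.measurable_fun_sum _ fun e _ => Measurable.const_mul ?_ _))
    exact measurable_from_top.comp (Loop.measurable_edgeJumps (e : Sym2 X))
  · rintro ⟨m, ξ⟩ T
    rw [← sum_mul_edgeJumps_mk k ξ T]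
    push_cast
    rfl
  · intro ξ
    -- For `m = 0` the only step goes from a site to itself, which is not an edge of `G`.
    have h : ∀ i : Fin 1, edgeExt k s(ξ i, ξ (i + 1)) = 0 := fun i => by
      rw [edgeExt, dif_neg]
      rw [Subsingleton.elim (i + 1) i]
      exact fun h => G.loopless.irrefl _ h
    simp [h]

end LoopTrace

/-! ### Symmetric matrices: determinants and Gaussian integrals -/

section Symmetric

variable {X : Type*} [Fintype X] [DecidableEq X]

theorem exists_orthogonal_diagonal {M : Matrix X X ℝ} (hM : M.IsSymm) :
    ∃ (U : Matrix X X ℝ) (lam : X → ℝ), U.transpose * U = 1 ∧ U * U.transpose = 1 ∧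
      M = U * Matrix.diagonal lam * U.transpose := by
  have hM' : M.IsHermitian := hM
  have hU := hM'.eigenvectorUnitary.2
  rw [Matrix.mem_unitaryGroup_iff, Matrix.star_eq_conjTranspose,
    Matrix.conjTranspose_eq_transpose_of_trivial] at hU
  refine ⟨hM'.eigenvectorUnitary, hM'.eigenvalues, mul_eq_one_comm.1 hU, hU, ?_⟩
  conv_lhs => rw [hM'.spectral_theorem, Unitary.conjStarAlgAut_apply]
  rw [Matrix.star_eq_conjTranspose, Matrix.conjTranspose_eq_transpose_of_trivial]
  rfl

variable {M U : Matrix X X ℝ} {lam : X → ℝ}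

theorem dotProduct_mulVec_mulVec_self (hU : U.transpose * U = 1) (y : X → ℝ) :
    U.mulVec y ⬝ᵥ U.mulVec y = ∑ i, y i ^ 2 := by
  rw [Matrix.dotProduct_mulVec, ← Matrix.vecMul_transpose, Matrix.vecMul_vecMul, hU,
    Matrix.vecMul_one, dotProduct]
  exact Finset.sum_congr rfl fun i _ => (sq _).symm

theorem dotProduct_diagonalized (hU : U.transpose * U = 1)
    (hM : M = U * Matrix.diagonal lam * U.transpose) (y : X → ℝ) :
    U.mulVec y ⬝ᵥ M.mulVec (U.mulVec y) = ∑ i, lam i * y i ^ 2 := by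
  rw [Matrix.mulVec_mulVec, hM, Matrix.mul_assoc, hU, Matrix.mul_one, ← Matrix.mulVec_mulVec,
    Matrix.dotProduct_mulVec, ← Matrix.vecMul_transpose, Matrix.vecMul_vecMul, hU,
    Matrix.vecMul_one, dotProduct]
  refine Finset.sum_congr rfl fun i _ => ?_
  rw [Matrix.mulVec_diagonal]
  ring

/-- The contraction hypothesis is tested on the `i`-th column of `U`, a unit eigenvector. -/
theorem abs_eigenvalue_lt_one (hU : U.transpose * U = 1)
    (hM : M = U * Matrix.diagonal lam * U.transpose)
    (h : ∀ f : X → ℝ, f ≠ 0 → |f ⬝ᵥ M.mulVec f| < f ⬝ᵥ f) (i : X) : |lam i| < 1 := by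
  have h1 := dotProduct_mulVec_mulVec_self hU (Pi.single i 1)
  have h2 := dotProduct_diagonalized hU hM (Pi.single i 1)
  have h3 : ∑ j, (Pi.single i 1 : X → ℝ) j ^ 2 = 1 := by
    rw [Finset.sum_eq_single i] <;> simp +contextual
  have h4 : ∑ j, lam j * (Pi.single i 1 : X → ℝ) j ^ 2 = lam i := by
    rw [Finset.sum_eq_single i] <;> simp +contextual
  rw [h3] at h1
  rw [h4] at h2
  have h5 := h (U.mulVec (Pi.single i 1)) fun h0 => by simp [h0] at h1
  rwa [h1, h2] at h5

theorem det_one_sub_diagonalized (hU : U * U.transpose = 1)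
    (hM : M = U * Matrix.diagonal lam * U.transpose) : (1 - M).det = ∏ i, (1 - lam i) := by
  have h : 1 - M = U * Matrix.diagonal (fun i => 1 - lam i) * U.transpose := by
    have h1 : (Matrix.diagonal fun i => 1 - lam i) = 1 - Matrix.diagonal lam := by
      rw [← Matrix.diagonal_one, Matrix.diagonal_sub]
    rw [h1, Matrix.mul_sub, Matrix.sub_mul, Matrix.mul_one, hU, ← hM]
  rw [h, Matrix.det_mul_right_comm, hU, Matrix.one_mul, Matrix.det_diagonal]

theorem trace_pow_diagonalized (hU : U.transpose * U = 1) (hU' : U * U.transpose = 1)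
    (hM : M = U * Matrix.diagonal lam * U.transpose) (n : ℕ) :
    (M ^ n).trace = ∑ i, lam i ^ n := by
  have h : M ^ n = U * Matrix.diagonal (fun i => lam i ^ n) * U.transpose := by
    induction n with
    | zero => simp [hU']
    | succ n ih =>
      rw [pow_succ, ih]
      rw [hM]
      rw [show U * Matrix.diagonal (fun i => lam i ^ n) * U.transpose *
          (U * Matrix.diagonal lam * U.transpose) =
          U * (Matrix.diagonal (fun i => lam i ^ n) * (U.transpose * U) * Matrix.diagonal lam) *
            U.transpose by simp only [Matrix.mul_assoc], hU, Matrix.mul_one,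
        Matrix.diagonal_mul_diagonal]
      simp_rw [pow_succ]
  rw [h, Matrix.trace_mul_comm, ← Matrix.mul_assoc, hU, Matrix.one_mul, Matrix.trace_diagonal]

theorem det_one_sub_pos (hM : M.IsSymm)
    (h : ∀ f : X → ℝ, f ≠ 0 → |f ⬝ᵥ M.mulVec f| < f ⬝ᵥ f) : 0 < (1 - M).det := by
  obtain ⟨U, lam, hU, hU', hMU⟩ := exists_orthogonal_diagonal hM
  rw [det_one_sub_diagonalized hU' hMU]
  exact Finset.prod_pos fun i _ => sub_pos.2 (abs_lt.1 (abs_eigenvalue_lt_one hU hMU h i)).2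

/-- Summing `∑ t^{n+1}/(n+1) = -log(1 - t)` over the eigenvalues gives the logarithm of the
determinant. -/
theorem hasSum_trace_pow_div (hM : M.IsSymm)
    (h : ∀ f : X → ℝ, f ≠ 0 → |f ⬝ᵥ M.mulVec f| < f ⬝ᵥ f) :
    HasSum (fun n : ℕ => (M ^ (n + 1)).trace / (n + 1)) (-Real.log (1 - M).det) := by
  obtain ⟨U, lam, hU, hU', hMU⟩ := exists_orthogonal_diagonal hM
  have hlam := abs_eigenvalue_lt_one hU hMU h
  rw [det_one_sub_diagonalized hU' hMU,
    Real.log_prod fun i _ => (sub_pos.2 (abs_lt.1 (hlam i)).2).ne', ← Finset.sum_neg_distrib]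
  simp_rw [trace_pow_diagonalized hU hU' hMU, Finset.sum_div]
  exact hasSum_sum fun i _ => Real.hasSum_pow_div_log_of_abs_lt_one (hlam i)

/-- The largest eigenvalue provides a uniform gap, needed for an integrable Gaussian bound. -/
theorem exists_lt_one_dotProduct_mulVec_le (hM : M.IsSymm)
    (h : ∀ f : X → ℝ, f ≠ 0 → |f ⬝ᵥ M.mulVec f| < f ⬝ᵥ f) :
    ∃ r < 1, ∀ f : X → ℝ, f ⬝ᵥ M.mulVec f ≤ r * (f ⬝ᵥ f) := by
  obtain ⟨U, lam, hU, hU', hMU⟩ := exists_orthogonal_diagonal hM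
  have hlam := abs_eigenvalue_lt_one hU hMU h
  rcases isEmpty_or_nonempty X with hX | hX
  · exact ⟨0, one_pos, fun f => by simp [dotProduct]⟩
  obtain ⟨i, hi⟩ := Finite.exists_max lam
  refine ⟨lam i, (abs_lt.1 (hlam i)).2, fun f => ?_⟩
  have hf : f = U.mulVec (U.transpose.mulVec f) := by
    rw [Matrix.mulVec_mulVec, hU', Matrix.one_mulVec]
  rw [hf, dotProduct_diagonalized hU hMU, dotProduct_mulVec_mulVec_self hU, Finset.mul_sum]
  exact Finset.sum_le_sum fun j _ => mul_le_mul_of_nonneg_right (hi j) (sq_nonneg _)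

theorem map_orthogonal_volume (hU : U.transpose * U = 1) :
    (volume : Measure (X → ℝ)).map (Matrix.toLin' U) = volume := by
  have h1 : U.det * U.det = 1 := by
    have := congrArg Matrix.det hU
    rwa [Matrix.det_mul, Matrix.det_transpose, Matrix.det_one] at this
  have h2 : |U.det| = 1 := by rcases mul_self_eq_one_iff.1 h1 with h | h <;> simp [h]
  rw [Real.map_matrix_volume_pi_eq_smul_volume_pi (by rintro h; simp [h] at h1), abs_inv, h2]
  simp

/-- The Gaussian integral of a quadratic form. -/
theorem integral_exp_quadratic (hM : M.IsSymm)
    (h : ∀ f : X → ℝ, f ≠ 0 → |f ⬝ᵥ M.mulVec f| < f ⬝ᵥ f) :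
    ∫ x : X → ℝ, Real.exp (-(x ⬝ᵥ x) / 2 + (x ⬝ᵥ M.mulVec x) / 2) =
      √(2 * Real.pi) ^ Fintype.card X / √(1 - M).det := by
  obtain ⟨U, lam, hU, hU', hMU⟩ := exists_orthogonal_diagonal hM
  have hlam := abs_eigenvalue_lt_one hU hMU h
  have hcont : Continuous fun x : X → ℝ =>
      Real.exp (-(x ⬝ᵥ x) / 2 + (x ⬝ᵥ M.mulVec x) / 2) := by
    simp only [Matrix.mulVec, dotProduct]
    fun_prop
  rw [← map_orthogonal_volume hU, integral_map
    (LinearMap.continuous_of_finiteDimensional _).aemeasurable hcont.aestronglyMeasurable]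
  have hterm : ∀ y : X → ℝ, Real.exp (-(Matrix.toLin' U y ⬝ᵥ Matrix.toLin' U y) / 2 +
      (Matrix.toLin' U y ⬝ᵥ M.mulVec (Matrix.toLin' U y)) / 2) =
      ∏ i, Real.exp (-((1 - lam i) / 2) * y i ^ 2) := by
    intro y
    rw [Matrix.toLin'_apply, dotProduct_diagonalized hU hMU, dotProduct_mulVec_mulVec_self hU,
      ← Real.exp_sum, ← Finset.sum_neg_distrib, Finset.sum_div, Finset.sum_div,
      ← Finset.sum_add_distrib]
    congr 1
    exact Finset.sum_congr rfl fun i _ => by ring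
  simp_rw [hterm]
  rw [integral_fintype_prod_volume_eq_prod fun i t => Real.exp (-((1 - lam i) / 2) * t ^ 2)]
  simp_rw [integral_gaussian]
  rw [det_one_sub_diagonalized hU' hMU, Real.sqrt_prod _ fun i _ =>
    (sub_pos.2 (abs_lt.1 (hlam i)).2).le, ← Finset.card_univ, ← Finset.prod_const,
    ← Finset.prod_div_distrib]
  refine Finset.prod_congr rfl fun i _ => ?_
  rw [← Real.sqrt_div (by positivity)]
  congr 1
  field_simp

/-- This is the dominating function for integrating the pairing series term by term. Passing to
`|x|` does not change `x ⬝ᵥ x`, so the uniform gap still yields Gaussian decay. -/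
theorem integrable_exp_quadratic_abs (hM : M.IsSymm)
    (h : ∀ f : X → ℝ, f ≠ 0 → |f ⬝ᵥ M.mulVec f| < f ⬝ᵥ f) :
    Integrable fun x : X → ℝ =>
      Real.exp (-(x ⬝ᵥ x) / 2 + ((fun i => |x i|) ⬝ᵥ M.mulVec fun i => |x i|) / 2) := by
  obtain ⟨r, hr, hle⟩ := exists_lt_one_dotProduct_mulVec_le hM h
  have hcont : Continuous fun x : X → ℝ =>
      Real.exp (-(x ⬝ᵥ x) / 2 + ((fun i => |x i|) ⬝ᵥ M.mulVec fun i => |x i|) / 2) := by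
    simp only [Matrix.mulVec, dotProduct]
    fun_prop
  refine Integrable.mono' (Integrable.fintype_prod
    (f := fun _ t => Real.exp (-((1 - r) / 2) * t ^ 2))
    fun _ => integrable_exp_neg_mul_sq (by linarith)) hcont.aestronglyMeasurable
    (.of_forall fun x => ?_)
  rw [Real.norm_of_nonneg (Real.exp_pos _).le, ← Real.exp_sum]
  refine Real.exp_le_exp.2 ?_
  have h1 : (fun i => |x i|) ⬝ᵥ (fun i => |x i|) = x ⬝ᵥ x := by simp [dotProduct]
  have h2 : ∑ i, -((1 - r) / 2) * x i ^ 2 = -((1 - r) / 2) * (x ⬝ᵥ x) := by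
    simp [dotProduct, Finset.mul_sum, sq]
  have h3 := hle fun i => |x i|
  rw [h1] at h3
  rw [h2]
  linarith

end Symmetric

/-! ### Moments of the Gaussian distribution -/

section Moments

theorem Gamma_nat_add_half_eq_factorial (c : ℕ) :
    Real.Gamma (c + 1 / 2) = (2 * c).factorial / (4 ^ c * c.factorial) * √Real.pi := by
  induction c with
  | zero => simp [Real.Gamma_one_half_eq, -one_div]
  | succ c ih =>
    rw [show ((c + 1 : ℕ) : ℝ) + 1 / 2 = (c + 1 / 2) + 1 by push_cast; ring,
      Real.Gamma_add_one (by positivity), ih, show 2 * (c + 1) = 2 * c + 1 + 1 by ring,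
      Nat.factorial_succ, Nat.factorial_succ, Nat.factorial_succ]
    push_cast
    field_simp
    ring

theorem integral_pow_even_mul_exp (c : ℕ) :
    ∫ t : ℝ, t ^ (2 * c) * Real.exp (-t ^ 2 / 2) =
      √(2 * Real.pi) * ((2 * c).factorial / (2 ^ c * c.factorial)) := by
  have h1 : ∀ t : ℝ, t ^ (2 * c) * Real.exp (-t ^ 2 / 2) =
      (fun t : ℝ => t ^ (2 * c) * Real.exp (-t ^ 2 / 2)) |t| := fun t => by
    simp only [pow_mul, sq_abs]
  have h2 : ∀ t ∈ Set.Ioi (0 : ℝ), t ^ (2 * c) * Real.exp (-t ^ 2 / 2) =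
      t ^ ((2 * c : ℕ) : ℝ) * Real.exp (-(1 / 2) * t ^ (2 : ℝ)) := fun t _ => by
    rw [Real.rpow_natCast, Real.rpow_two]
    congr 2
    ring
  rw [integral_congr_ae (.of_forall h1),
    integral_comp_abs (f := fun t : ℝ => t ^ (2 * c) * Real.exp (-t ^ 2 / 2)),
    setIntegral_congr_fun measurableSet_Ioi h2,
    integral_rpow_mul_exp_neg_mul_rpow two_pos
      (by have := (2 * c).cast_nonneg (α := ℝ); linarith) (by norm_num),
    show (((2 * c : ℕ) : ℝ) + 1) / 2 = c + 1 / 2 by push_cast; ring,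
    Gamma_nat_add_half_eq_factorial,
    show -(((2 * c : ℕ) : ℝ) + 1) / 2 = -(c + 1 / 2) by push_cast; ring,
    one_div, Real.inv_rpow two_pos.le, Real.rpow_neg two_pos.le, inv_inv,
    Real.rpow_add two_pos, Real.rpow_natCast, ← one_div, ← Real.sqrt_eq_rpow,
    Real.sqrt_mul two_pos.le, show (4 : ℝ) ^ c = 2 ^ c * 2 ^ c by rw [← mul_pow]; norm_num]
  field_simp

theorem integral_pow_odd_mul_exp {n : ℕ} (hn : Odd n) :
    ∫ t : ℝ, t ^ n * Real.exp (-t ^ 2 / 2) = 0 := by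
  have h := integral_neg_eq_self (fun t : ℝ => t ^ n * Real.exp (-t ^ 2 / 2)) volume
  simp_rw [hn.neg_pow, neg_sq, neg_mul] at h
  rw [integral_neg] at h
  linarith

end Moments

/-! ### Pairings -/

section Pairings

/-- A fixed point free involution. -/
def IsPairing {H : Type*} (π : Equiv.Perm H) : Prop :=
  (∀ h, π (π h) = h) ∧ ∀ h, π h ≠ h

theorem IsPairing.conj {H H' : Type*} {π : Equiv.Perm H} (hπ : IsPairing π) (σ : H ≃ H') :
    IsPairing ((σ.symm.trans π).trans σ) := by
  refine ⟨fun h => ?_, fun h h' => hπ.2 (σ.symm h) ?_⟩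
  · simp [hπ.1]
  · exact σ.injective (by simpa using h')

theorem isPairing_conj_iff {H H' : Type*} {π : Equiv.Perm H} (σ : H ≃ H') :
    IsPairing ((σ.symm.trans π).trans σ) ↔ IsPairing π := by
  refine ⟨fun h => ?_, fun h => h.conj σ⟩
  convert! h.conj σ.symm
  ext; simp

variable {H : Type*} [Fintype H] [DecidableEq H]

/-- Pairings form a single conjugacy class, so counting them and moving one to another reduce to
facts about cycle types. -/
theorem isPairing_iff_cycleType {m : ℕ} (hm : Fintype.card H = 2 * m) (π : Equiv.Perm H) :
    IsPairing π ↔ π.cycleType = Multiset.replicate m 2 := by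
  have hsq : (∀ h, π (π h) = h) ↔ π ^ 2 = 1 := by
    rw [Equiv.ext_iff]; simp [sq]
  constructor
  · rintro ⟨h1, h2⟩
    have h3 := Equiv.Perm.cycleType_of_pow_prime_eq_one (p := 2) (hsq.1 h1)
    have h4 : π.support = Finset.univ := Finset.eq_univ_of_forall fun h =>
      Equiv.Perm.mem_support.2 (h2 h)
    have h5 := π.sum_cycleType
    rw [h4, Finset.card_univ, hm, h3, Multiset.sum_replicate, smul_eq_mul] at h5
    rw [h3]
    congr 1
    omega
  · intro h
    refine ⟨hsq.2 ((Equiv.Perm.pow_prime_eq_one_iff (p := 2)).2 fun c hc => ?_), fun x => ?_⟩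
    · rw [h] at hc
      exact Multiset.eq_of_mem_replicate hc
    · rw [← Equiv.Perm.mem_support]
      have h5 := π.sum_cycleType
      rw [h, Multiset.sum_replicate, smul_eq_mul] at h5
      rw [(Finset.card_eq_iff_eq_univ _).1 (h5.symm.trans ((mul_comm _ _).trans hm.symm))]
      exact Finset.mem_univ x

theorem IsPairing.even_card {π : Equiv.Perm H} (hπ : IsPairing π) : Even (Fintype.card H) := by
  have h1 : π ^ 2 = 1 := by ext h; simp [sq, hπ.1]
  have h3 := Equiv.Perm.cycleType_of_pow_prime_eq_one (p := 2) h1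
  have h4 : π.support = Finset.univ := Finset.eq_univ_of_forall fun h =>
    Equiv.Perm.mem_support.2 (hπ.2 h)
  have h5 := π.sum_cycleType
  rw [h4, Finset.card_univ, h3, Multiset.sum_replicate, smul_eq_mul] at h5
  exact ⟨_, h5.symm.trans (mul_two _)⟩

open Classical in
/-- The number of pairings of `2 m` elements. -/
theorem card_isPairing {m : ℕ} (hm : Fintype.card H = 2 * m) :
    ((Finset.univ.filter fun π : Equiv.Perm H => IsPairing π).card : ℝ) =
      (2 * m).factorial / (2 ^ m * m.factorial) := by
  have h0 : (Finset.univ.filter fun π : Equiv.Perm H => IsPairing π) =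
      Finset.univ.filter fun π : Equiv.Perm H => π.cycleType = Multiset.replicate m 2 :=
    Finset.filter_congr fun π _ => isPairing_iff_cycleType hm π
  have h1 := Equiv.Perm.card_of_cycleType_mul_eq H (Multiset.replicate m 2)
  rw [if_pos ⟨by rw [Multiset.sum_replicate, hm, smul_eq_mul, mul_comm],
    fun a ha => (Multiset.eq_of_mem_replicate ha).ge⟩, Multiset.sum_replicate, hm, smul_eq_mul,
    mul_comm m 2, Nat.sub_self, Nat.factorial_zero, one_mul, Multiset.prod_replicate] at h1
  have h2 : ∏ n ∈ (Multiset.replicate m 2).toFinset,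
      ((Multiset.replicate m 2).count n).factorial = m.factorial := by
    rcases Nat.eq_zero_or_pos m with rfl | hm0
    · simp
    · rw [Multiset.toFinset_replicate, if_neg hm0.ne']
      simp
  rw [h2] at h1
  rw [h0, eq_div_iff (by positivity)]
  exact_mod_cast h1

/-- The pairing of `Fin m × Bool` that exchanges `(i, false)` and `(i, true)`. -/
def stdPairing (m : ℕ) : Equiv.Perm (Fin m × Bool) :=
  (Equiv.refl _).prodCongr Equiv.boolNot

theorem isPairing_stdPairing (m : ℕ) : IsPairing (stdPairing m) := by
  refine ⟨fun ⟨i, b⟩ => ?_, fun h h' => ?_⟩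
  · simp [stdPairing]
  · simp [stdPairing, Prod.ext_iff] at h'

theorem IsPairing.exists_equiv {m : ℕ} (hm : Fintype.card H = 2 * m) {π : Equiv.Perm H}
    (hπ : IsPairing π) :
    ∃ σ : Fin m × Bool ≃ H, ∀ h, σ (stdPairing m h) = π (σ h) := by
  have e : Fin m × Bool ≃ H := Fintype.equivOfCardEq (by simp [hm, mul_comm])
  have h1 := (isPairing_iff_cycleType hm _).1 ((isPairing_stdPairing m).conj e)
  have h2 := Equiv.Perm.isConj_iff_cycleType_eq.2 (h1.trans
    ((isPairing_iff_cycleType hm π).1 hπ).symm)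
  obtain ⟨c, hc⟩ := isConj_iff.1 h2
  refine ⟨e.trans c, fun h => ?_⟩
  rw [← hc]
  simp

variable {X R : Type*} [Fintype X] [CommRing R]

/-- The sum over all colourings, for a fixed pairing. -/
theorem sum_colouring_pairing {m : ℕ} (hm : Fintype.card H = 2 * m)
    {π : Equiv.Perm H} (hπ : IsPairing π) (φ : X → R) (K : X → X → R) :
    ∑ v : H → X, ∏ h, (φ (v h) * K (v h) (v (π h))) =
      (∑ x, ∑ y, φ x * φ y * (K x y * K y x)) ^ m := by
  classical
  obtain ⟨σ, hσ⟩ := hπ.exists_equiv hm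
  -- Transported to `Fin m × Bool`, a colouring is a choice of `m` independent pairs of colours, so
  -- the sum factors as an `m`-th power.
  rw [← (Equiv.arrowCongr σ (Equiv.refl X)).sum_comp, ← Fintype.sum_prod_type', ← Fin.prod_const,
    Finset.prod_univ_sum, Fintype.piFinset_univ,
    ← (Equiv.curry (Fin m) Bool X).symm.sum_comp,
    ← (Equiv.arrowCongr (Equiv.refl (Fin m)) (Equiv.boolArrowEquivProd X).symm).sum_comp]
  refine Finset.sum_congr rfl fun v _ => ?_
  rw [← σ.prod_comp, Fintype.prod_prod_type]
  refine Finset.prod_congr rfl fun i _ => ?_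
  simp [← hσ, stdPairing]
  ring

end Pairings

/-! ### The generating function of pairings -/

section PairingSum

variable {X : Type*} {H H' : Type*} [Fintype H] [Fintype H']

open Classical in
/-- The sum over the pairings `π` of `∏_h K (v h) (v (π h))`. -/
def pairingSum (K : X → X → ℝ) (v : H → X) : ℝ :=
  ∑ π : Equiv.Perm H with IsPairing π, ∏ h, K (v h) (v (π h))

theorem pairingSum_comp_equiv (K : X → X → ℝ) (v : H → X) (σ : H' ≃ H) :
    pairingSum K (v ∘ σ) = pairingSum K v := by
  classical
  unfold pairingSum
  refine Finset.sum_equiv (σ.equivCongr σ) (fun π => ?_) (fun π _ => ?_)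
  · simp only [Finset.mem_filter_univ]
    exact (isPairing_conj_iff σ).symm
  · rw [← σ.prod_comp]
    simp

theorem pairingSum_nonneg {K : X → X → ℝ} (hK : ∀ x y, 0 ≤ K x y) (v : H → X) :
    0 ≤ pairingSum K v :=
  Finset.sum_nonneg fun _ _ => Finset.prod_nonneg fun _ _ => hK _ _

theorem pairingSum_eq_zero_of_odd (K : X → X → ℝ) (v : H → X) (hH : ¬ Even (Fintype.card H)) :
    pairingSum K v = 0 := by
  classical
  refine Finset.sum_eq_zero fun π hπ => ?_
  exact absurd (Finset.mem_filter_univ π |>.1 hπ).even_card hH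

variable [Fintype X]

/-- After exchanging the sums every pairing contributes the same `m`-th power, so only the number of
pairings remains. -/
theorem sum_prod_mul_pairingSum {m : ℕ} (hm : Fintype.card H = 2 * m) (K : X → X → ℝ)
    (φ : X → ℝ) [Fintype (H → X)] :
    ∑ v : H → X, (∏ h, φ (v h)) * pairingSum K v =
      (2 * m).factorial / (2 ^ m * m.factorial) *
        (∑ x, ∑ y, φ x * φ y * (K x y * K y x)) ^ m := by
  classical
  simp_rw [pairingSum, Finset.mul_sum]
  rw [Finset.sum_comm, ← card_isPairing hm, ← nsmul_eq_mul, ← Finset.sum_const]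
  refine Finset.sum_congr rfl fun π hπ => ?_
  rw [← sum_colouring_pairing hm (Finset.mem_filter_univ π |>.1 hπ)]
  simp_rw [Finset.prod_mul_distrib]
  congr!

/-- The sum over pairings of a set of half-edges with `d x` elements at `x`. -/
def degreeSum (K : X → X → ℝ) (d : X → ℕ) : ℝ :=
  pairingSum K (Sigma.fst : (Σ x, Fin (d x)) → X)

theorem degreeSum_nonneg {K : X → X → ℝ} (hK : ∀ x y, 0 ≤ K x y) (d : X → ℕ) :
    0 ≤ degreeSum K d :=
  pairingSum_nonneg hK _

variable [DecidableEq X]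

/-- The number of elements of each colour. -/
def colourCount (v : H → X) (x : X) : ℕ := Fintype.card {h // v h = x}

theorem sum_colourCount (v : H → X) : ∑ x, colourCount v x = Fintype.card H := by
  rw [← Fintype.card_congr (Equiv.sigmaFiberEquiv v), Fintype.card_sigma]
  rfl

theorem colourCount_sigma_fst (d : X → ℕ) (σ : H ≃ Σ x, Fin (d x)) :
    colourCount (fun h => (σ h).1) = d := by
  ext x
  rw [colourCount, Fintype.card_congr (σ.subtypeEquiv (q := fun s => s.1 = x) fun h => Iff.rfl),
    Fintype.card_congr (Equiv.sigmaSubtype (β := fun x => Fin (d x)) x), Fintype.card_fin]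

/-- Composition with one fixed bijection inducing `v` identifies all such bijections with the
permutations that preserve `v`, that is, with permutations inside each colour class. -/
theorem card_equiv_sigma_fst_eq [DecidableEq H] (d : X → ℕ) (v : H → X) :
    (Finset.univ.filter fun σ : H ≃ Σ x, Fin (d x) => (fun h => (σ h).1) = v).card =
      if colourCount v = d then ∏ x, (d x).factorial else 0 := by
  split_ifs with hv
  · let σ₀ : H ≃ Σ x, Fin (d x) := (Equiv.sigmaFiberEquiv v).symm.trans
      (Equiv.sigmaCongrRight fun x => Fintype.equivFinOfCardEq (congrFun hv x))
    have hσ₀ : ∀ s, v (σ₀.symm s) = s.1 := by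
      intro s
      obtain ⟨h, rfl⟩ := σ₀.surjective s
      rw [Equiv.symm_apply_apply]
      rfl
    rw [← Fintype.card_subtype, Fintype.card_congr
      (((Equiv.refl H).equivCongr σ₀.symm).subtypeEquiv 
        (q := fun g : Equiv.Perm H => v ∘ g = v) fun σ => by
        simp only [funext_iff, Function.comp_apply]
        simp [hσ₀]), DomMulAct.stabilizer_card]
    exact Finset.prod_congr rfl fun x _ => congrArg _ (congrFun hv x)
  · rw [Finset.card_eq_zero, Finset.filter_eq_empty_iff]
    rintro σ - rfl
    exact hv (colourCount_sigma_fst d σ)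

theorem sum_equiv_sigma_fst [DecidableEq H] (d : X → ℕ) (F : (H → X) → ℝ) :
    ∑ σ : H ≃ Σ x, Fin (d x), F (fun h => (σ h).1) =
      (∏ x, ((d x).factorial : ℝ)) * ∑ v with colourCount v = d, F v := by
  rw [← Finset.sum_fiberwise (g := fun (σ : H ≃ Σ x, Fin (d x)) h => (σ h).1), Finset.sum_filter,
    Finset.mul_sum]
  refine Finset.sum_congr rfl fun v _ => ?_
  rw [Finset.sum_congr rfl (g := fun _ => F v) fun σ hσ =>
    congrArg F (Finset.mem_filter_univ σ |>.1 hσ), Finset.sum_const, card_equiv_sigma_fst_eq,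
    nsmul_eq_mul]
  split_ifs <;> simp

/-- Double counting of labellings: the bijections from `Fin N` to the half-edges of degrees `d` give
`N!` equal terms, while each colouring with colour counts `d` comes from `∏ d_x!` of them. -/
theorem sum_piAntidiag_degreeSum_aux (K : X → X → ℝ) (φ : X → ℝ) (N : ℕ) :
    ∑ d ∈ Finset.univ.piAntidiag N,
        degreeSum K d / (∏ x, ((d x).factorial : ℝ)) * ∏ x, φ x ^ d x =
      (∑ v : Fin N → X, (∏ h, φ (v h)) * pairingSum K v) / N.factorial := by
  rw [← Finset.sum_fiberwise_of_maps_to (s := (Finset.univ : Finset (Fin N → X)))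
    (g := colourCount) (t := Finset.univ.piAntidiag N),
    Finset.sum_div]
  · refine Finset.sum_congr rfl fun d hd => ?_
    have h := sum_equiv_sigma_fst (H := Fin N) d fun v => (∏ h, φ (v h)) * pairingSum K v
    have hcard : Fintype.card (Fin N) = Fintype.card (Σ x, Fin (d x)) := by
      rw [Fintype.card_sigma]
      simp [(Finset.mem_piAntidiag.1 hd).1]
    have hF : ∀ σ : Fin N ≃ Σ x, Fin (d x), (∏ h, φ (σ h).1) * pairingSum K (fun h => (σ h).1) =
        (∏ x, φ x ^ d x) * degreeSum K d := by
      intro σ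
      rw [σ.prod_comp fun s => φ s.1, Fintype.prod_sigma, degreeSum,
        ← pairingSum_comp_equiv K Sigma.fst σ]
      simp [Function.comp_def]
    simp_rw [hF] at h
    rw [Finset.sum_const, Finset.card_univ, Fintype.card_equiv (Fintype.equivOfCardEq hcard),
      Fintype.card_fin, nsmul_eq_mul] at h
    have hd0 : (∏ x, ((d x).factorial : ℝ)) ≠ 0 :=
      Finset.prod_ne_zero_iff.2 fun x _ => by positivity
    rw [div_mul_eq_mul_div, div_eq_div_iff hd0 (by positivity)]
    linear_combination h
  · intro v _
    rw [Finset.mem_piAntidiag]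
    exact ⟨(sum_colourCount v).trans (Fintype.card_fin N), fun _ _ => Finset.mem_univ _⟩

theorem sum_piAntidiag_degreeSum_even (K : X → X → ℝ) (φ : X → ℝ) (m : ℕ) :
    ∑ d ∈ Finset.univ.piAntidiag (2 * m),
        degreeSum K d / (∏ x, ((d x).factorial : ℝ)) * ∏ x, φ x ^ d x =
      ((∑ x, ∑ y, φ x * φ y * (K x y * K y x)) / 2) ^ m / m.factorial := by
  rw [sum_piAntidiag_degreeSum_aux, sum_prod_mul_pairingSum (Fintype.card_fin _), div_pow]
  field_simp

theorem sum_piAntidiag_degreeSum_odd (K : X → X → ℝ) (φ : X → ℝ) {N : ℕ} (hN : ¬ Even N) :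
    ∑ d ∈ Finset.univ.piAntidiag N,
        degreeSum K d / (∏ x, ((d x).factorial : ℝ)) * ∏ x, φ x ^ d x = 0 := by
  rw [sum_piAntidiag_degreeSum_aux, Finset.sum_eq_zero, zero_div]
  intro v _
  rw [pairingSum_eq_zero_of_odd K v (by rwa [Fintype.card_fin]), mul_zero]

/-- Functions `X → ℕ` graded by their sum. -/
def piGrading (X : Type*) [Fintype X] [DecidableEq X] :
    (Σ N : ℕ, (Finset.univ.piAntidiag N : Finset (X → ℕ))) ≃ (X → ℕ) where
  toFun p := p.2.1
  invFun d := ⟨∑ x, d x, d, Finset.mem_piAntidiag.2 ⟨rfl, fun _ _ => Finset.mem_univ _⟩⟩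
  left_inv := by
    rintro ⟨N, d, hd⟩
    obtain rfl := (Finset.mem_piAntidiag.1 hd).1
    rfl
  right_inv _ := rfl

theorem hasSum_grade (K : X → X → ℝ) (φ : X → ℝ) :
    HasSum (fun N => ∑ d ∈ Finset.univ.piAntidiag N,
        degreeSum K d / (∏ x, ((d x).factorial : ℝ)) * ∏ x, φ x ^ d x)
      (Real.exp ((∑ x, ∑ y, φ x * φ y * (K x y * K y x)) / 2)) := by
  have hinj : Function.Injective fun m : ℕ => 2 * m := fun a b h => by simpa using h
  rw [← hinj.hasSum_iff]
  · simp_rw [Function.comp_def, sum_piAntidiag_degreeSum_even, Real.exp_eq_exp_ℝ]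
    exact NormedSpace.expSeries_div_hasSum_exp _
  · intro N hN
    refine sum_piAntidiag_degreeSum_odd K φ fun h => hN ?_
    obtain ⟨m, rfl⟩ := h.exists_two_nsmul
    exact ⟨m, by simp⟩

/-- Summation by total degree is the exponential series. Ungrouping the terms requires absolute
convergence, which is the same statement for `|φ|` since the coefficients are nonnegative. -/
theorem hasSum_degreeSum {K : X → X → ℝ} (hK : ∀ x y, 0 ≤ K x y) (φ : X → ℝ) :
    HasSum (fun d : X → ℕ => degreeSum K d / (∏ x, ((d x).factorial : ℝ)) * ∏ x, φ x ^ d x)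
      (Real.exp ((∑ x, ∑ y, φ x * φ y * (K x y * K y x)) / 2)) := by
  have hfib : ∀ (f : (X → ℕ) → ℝ) (N : ℕ),
      HasSum (fun c : (Finset.univ.piAntidiag N : Finset (X → ℕ)) => (f ∘ piGrading X) ⟨N, c⟩)
        (∑ d ∈ Finset.univ.piAntidiag N, f d) := fun f N => by
    rw [← Finset.sum_coe_sort]
    exact hasSum_fintype _
  rw [← (piGrading X).hasSum_iff]
  refine HasSum.sigma_of_hasSum (hasSum_grade K φ) (hfib _) (Summable.of_norm ?_)
  have habs : ∀ p, ‖((fun d : X → ℕ => degreeSum K d / (∏ x, ((d x).factorial : ℝ)) *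
      ∏ x, φ x ^ d x) ∘ piGrading X) p‖ = ((fun d : X → ℕ => degreeSum K d /
      (∏ x, ((d x).factorial : ℝ)) * ∏ x, |φ x| ^ d x) ∘ piGrading X) p := by
    intro p
    simp only [Function.comp_apply, Real.norm_eq_abs]
    rw [abs_mul, Finset.abs_prod, abs_of_nonneg (div_nonneg (degreeSum_nonneg hK _)
      (Finset.prod_nonneg fun _ _ => Nat.cast_nonneg _))]
    simp_rw [abs_pow]
  simp_rw [habs]
  rw [summable_sigma_of_nonneg]
  · refine ⟨fun N => (hfib _ N).summable, ?_⟩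
    simp_rw [fun N => (hfib (fun d : X → ℕ => degreeSum K d /
      (∏ x, ((d x).factorial : ℝ)) * ∏ x, |φ x| ^ d x) N).tsum_eq]
    exact (hasSum_grade K fun x => |φ x|).summable
  · intro p
    exact mul_nonneg (div_nonneg (degreeSum_nonneg hK _)
      (Finset.prod_nonneg fun _ _ => Nat.cast_nonneg _))
      (Finset.prod_nonneg fun _ _ => pow_nonneg (abs_nonneg _) _)

end PairingSum

/-! ### Gaussian evaluation of the sum over pairings -/

section GaussianEvaluation

variable {X : Type*} [Fintype X]

theorem integral_prod_pow_mul_exp (d : X → ℕ) :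
    ∫ x : X → ℝ, (∏ i, x i ^ d i) * Real.exp (-(x ⬝ᵥ x) / 2) =
      ∏ i, ∫ t : ℝ, t ^ d i * Real.exp (-t ^ 2 / 2) := by
  rw [← integral_fintype_prod_volume_eq_prod fun i t => t ^ d i * Real.exp (-t ^ 2 / 2)]
  refine integral_congr_ae (.of_forall fun x => ?_)
  simp only [dotProduct, Finset.prod_mul_distrib, ← Real.exp_sum, ← Finset.sum_neg_distrib,
    Finset.sum_div, sq]

theorem sum_mul_eq_dotProduct_mulVec (K : X → X → ℝ) (φ : X → ℝ) :
    ∑ x, ∑ y, φ x * φ y * (K x y * K y x) =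
      φ ⬝ᵥ (Matrix.of fun x y => K x y * K y x).mulVec φ := by
  simp only [Matrix.mulVec, dotProduct, Matrix.of_apply, Finset.mul_sum]
  exact Finset.sum_congr rfl fun x _ => Finset.sum_congr rfl fun y _ => by ring

variable [DecidableEq X]

/-- The sum over all pairings of half-edges, with an even number of them at each vertex. -/
theorem hasSum_even_degreeSum {K : X → X → ℝ} (hK : ∀ x y, 0 ≤ K x y)
    (h : ∀ f : X → ℝ, f ≠ 0 →
      |f ⬝ᵥ (Matrix.of fun x y => K x y * K y x).mulVec f| < f ⬝ᵥ f) :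
    HasSum (fun c : X → ℕ => (∏ x, 1 / (2 ^ c x * ((c x).factorial : ℝ))) *
        degreeSum K fun x => 2 * c x)
      (1 / √(1 - Matrix.of fun x y => K x y * K y x).det) := by
  set M : Matrix X X ℝ := Matrix.of fun x y => K x y * K y x with hMdef
  have hM : M.IsSymm := by ext x y; simp [hMdef, mul_comm]
  have hcoef : ∀ d : X → ℕ, 0 ≤ degreeSum K d / (∏ x, ((d x).factorial : ℝ)) := fun d =>
    div_nonneg (degreeSum_nonneg hK _) (Finset.prod_nonneg fun _ _ => Nat.cast_nonneg _)
  -- The monomial variable `z` is kept apart from the Gaussian variable `x`, so that `z = |x|` gives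
  -- the dominating series and `z = x` the actual one.
  let F : (X → ℝ) → (X → ℕ) → (X → ℝ) → ℝ := fun z d x =>
    degreeSum K d / (∏ x, ((d x).factorial : ℝ)) * (∏ i, z i ^ d i) * Real.exp (-(x ⬝ᵥ x) / 2)
  have hF : ∀ z x, HasSum (fun d => F z d x)
      (Real.exp (-(x ⬝ᵥ x) / 2 + (z ⬝ᵥ M.mulVec z) / 2)) := by
    intro z x
    rw [add_comm, Real.exp_add, ← sum_mul_eq_dotProduct_mulVec]
    exact (hasSum_degreeSum hK z).mul_right _
  have hmain : HasSum (fun d => ∫ x : X → ℝ, F x d x)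
      (∫ x : X → ℝ, Real.exp (-(x ⬝ᵥ x) / 2 + (x ⬝ᵥ M.mulVec x) / 2)) := by
    refine hasSum_integral_of_dominated_convergence (fun d x => F (fun i => |x i|) d x)
      (fun d => ?_) (fun d => .of_forall fun x => ?_)
      (.of_forall fun x => (hF _ x).summable) ?_ (.of_forall fun x => hF x x)
    · refine Continuous.aestronglyMeasurable ?_
      simp only [F, dotProduct]
      fun_prop
    · simp only [F]
      rw [Real.norm_eq_abs, abs_mul, abs_mul, abs_of_nonneg (hcoef d), Finset.abs_prod,
        Real.abs_exp]
      simp_rw [abs_pow]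
      exact le_rfl
    · simp_rw [fun x => (hF (fun i => |x i|) x).tsum_eq]
      exact integrable_exp_quadratic_abs hM h
  have hint : ∀ d, ∫ x : X → ℝ, F x d x = degreeSum K d / (∏ x, ((d x).factorial : ℝ)) *
      ∏ i, ∫ t : ℝ, t ^ d i * Real.exp (-t ^ 2 / 2) := by
    intro d
    simp only [F, mul_assoc]
    rw [integral_const_mul, integral_prod_pow_mul_exp]
  simp_rw [hint] at hmain
  -- A degree vector with an odd entry contributes a vanishing Gaussian moment, so only the vectors
  -- `2c` survive.
  have hinj : Function.Injective fun (c : X → ℕ) x => 2 * c x := fun a b hab => by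
    ext x; simpa using congrFun hab x
  rw [← hinj.hasSum_iff, integral_exp_quadratic hM h] at hmain
  · have h2 := hmain.div_const (√(2 * Real.pi) ^ Fintype.card X)
    have hpi : √(2 * Real.pi) ^ Fintype.card X ≠ 0 := by positivity
    rw [div_right_comm, div_self hpi] at h2
    refine h2.congr_fun fun c => ?_
    simp only [Function.comp_apply, integral_pow_even_mul_exp]
    rw [eq_div_iff hpi, Finset.prod_mul_distrib, Finset.prod_const, Finset.card_univ,
      Finset.prod_div_distrib, Finset.prod_div_distrib, Finset.prod_const_one]
    have hd0 : (∏ x, ((2 * c x).factorial : ℝ)) ≠ 0 :=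
      Finset.prod_ne_zero_iff.2 fun x _ => by positivity
    field_simp
  · intro d hd
    obtain ⟨x, hx⟩ : ∃ x, Odd (d x) := by
      by_contra! hne
      choose c hc using fun x => (Nat.not_odd_iff_even.1 (hne x)).exists_two_nsmul
      exact hd ⟨c, by ext x; simp [hc x]⟩
    have h0 : ∏ i, ∫ t : ℝ, t ^ d i * Real.exp (-t ^ 2 / 2) = 0 :=
      Finset.prod_eq_zero (Finset.mem_univ x) (integral_pow_odd_mul_exp hx)
    rw [h0, mul_zero]

end GaussianEvaluation

/-! ### The total weight of the even configurations -/

section Configurations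

variable {X : Type*} {G : SimpleGraph X} [DecidableRel G.Adj]

/-- The square root of the weight of the edges of `G`, and `0` off the edges. -/
def sqrtKernel (G : SimpleGraph X) [DecidableRel G.Adj] (w : Sym2 X → ℝ) (x y : X) : ℝ :=
  if G.Adj x y then √(w s(x, y)) else 0

theorem sqrtKernel_nonneg (w : Sym2 X → ℝ) (x y : X) : 0 ≤ sqrtKernel G w x y := by
  unfold sqrtKernel; split_ifs <;> positivity

variable [Fintype X] [DecidableEq X]

omit [DecidableRel G.Adj] in
-- Each copy of `{x,y}` has one half-edge at either end, and `x ≠ y` keeps the two families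
-- disjoint.
theorem card_half_edges (c : EvenConfig G) {e : Sym2 X} (he : ¬ e.IsDiag) :
    (Finset.univ.filter fun h => s(h.1, (c.couple h).1) = e).card = 2 * c.edgeMult e := by
  induction e with
  | _ x y =>
    have hxy : x ≠ y := he
    have hm : ∀ x y, (Finset.univ.filter fun h => h.1 = x ∧ (c.couple h).1 = y).card =
        c.mult x y := by
      intro x y
      rw [EvenConfig.mult, Fintype.card_subtype]
      refine (Finset.card_bij (fun i _ => ⟨x, i⟩) ?_ ?_ ?_).symm
      · simp
      · simp
      · rintro ⟨x', i⟩ hi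
        obtain ⟨rfl, hi⟩ := Finset.mem_filter_univ _ |>.1 hi
        exact ⟨i, by simpa using hi, rfl⟩
    change _ = 2 * c.mult x y
    rw [two_mul]
    nth_rewrite 2 [c.mult_comm]
    rw [← hm, ← hm, ← Finset.card_union_of_disjoint, ← Finset.filter_or]
    · congr 1
      ext h
      simp
    · rw [Finset.disjoint_filter]
      rintro h - ⟨h1, -⟩ ⟨h2, -⟩
      exact hxy (h1.symm.trans h2)

/-- A product over half-edges meets every edge of the map twice, hence the square root in the
kernel. -/
theorem prod_edgeFinset_pow (c : EvenConfig G) {w : Sym2 X → ℝ} (hw : ∀ e, 0 ≤ w e) :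
    ∏ e ∈ G.edgeFinset, w e ^ c.edgeMult e = ∏ h, sqrtKernel G w h.1 (c.couple h).1 := by
  have h1 : ∀ h, sqrtKernel G w h.1 (c.couple h).1 = √(w s(h.1, (c.couple h).1)) := fun h =>
    if_pos (c.adj h)
  simp_rw [h1]
  rw [← Finset.prod_fiberwise_of_maps_to (g := fun h => s(h.1, (c.couple h).1))
    (t := G.edgeFinset) fun h _ => by simpa using c.adj h]
  refine Finset.prod_congr rfl fun e he => ?_
  rw [Finset.prod_congr rfl (g := fun _ => √(w e)) fun h hh => by
    rw [Finset.mem_filter_univ _ |>.1 hh], Finset.prod_const,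
    card_half_edges c (G.not_isDiag_of_mem_edgeFinset he), pow_mul, Real.sq_sqrt (hw e)]

/-- Configurations as families of half-edges with a pairing. -/
def EvenConfig.equivSigma (G : SimpleGraph X) :
    (Σ c : X → ℕ, {π : Equiv.Perm (Σ x, Fin (2 * c x)) //
      (∀ h, π (π h) = h) ∧ ∀ h, G.Adj h.1 (π h).1}) ≃ EvenConfig G where
  toFun p := ⟨p.1, p.2.1, p.2.2.1, p.2.2.2⟩
  invFun c := ⟨c.c, ⟨c.couple, c.couple, c.couple_couple, c.couple_couple⟩, c.couple_couple, c.adj⟩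
  left_inv := by
    rintro ⟨c, π, h1, h2⟩
    exact congrArg (Sigma.mk c) (Subtype.ext (Equiv.ext fun _ => rfl))
  right_inv _ := rfl

/-- A pairing that does not follow the edges of `G` has weight zero, and conversely adjacency
excludes fixed points. -/
theorem sum_config_eq_degreeSum (w : Sym2 X → ℝ) (c : X → ℕ)
    [Fintype {π : Equiv.Perm (Σ x, Fin (2 * c x)) //
      (∀ h, π (π h) = h) ∧ ∀ h, G.Adj h.1 (π h).1}] :
    ∑ π : {π : Equiv.Perm (Σ x, Fin (2 * c x)) //
      (∀ h, π (π h) = h) ∧ ∀ h, G.Adj h.1 (π h).1}, ∏ h, sqrtKernel G w h.1 (π.1 h).1 =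
      degreeSum (sqrtKernel G w) fun x => 2 * c x := by
  classical
  rw [← Finset.sum_subtype (Finset.univ.filter
    fun π : Equiv.Perm (Σ x, Fin (2 * c x)) => (∀ h, π (π h) = h) ∧ ∀ h, G.Adj h.1 (π h).1)
    (fun π => Finset.mem_filter_univ π) fun π => ∏ h, sqrtKernel G w h.1 (π h).1]
  have hsub : ∀ f : Equiv.Perm (Σ x, Fin (2 * c x)) → ℝ,
      (∀ π, IsPairing π → (¬ ∀ h, G.Adj h.1 (π h).1) → f π = 0) →
      ∑ π with (∀ h, π (π h) = h) ∧ ∀ h, G.Adj h.1 (π h).1, f π = ∑ π with IsPairing π, f π := by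
    intro f hf
    refine Finset.sum_subset (fun π hπ => ?_) fun π hπ hπ' => ?_
    · obtain ⟨h1, h2⟩ := (Finset.mem_filter.1 hπ).2
      have hp : IsPairing π := ⟨h1, fun h h' => (h2 h).ne (congrArg Sigma.fst h').symm⟩
      exact Finset.mem_filter.2 ⟨Finset.mem_univ _, hp⟩
    · have hp : IsPairing π := (Finset.mem_filter.1 hπ).2
      exact hf π hp fun h3 => hπ' (Finset.mem_filter.2 ⟨Finset.mem_univ _, hp.1, h3⟩)
  rw [hsub _ fun π _ hadj => ?_]
  · unfold degreeSum pairingSum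
    congr!
  · push Not at hadj
    obtain ⟨h, hh⟩ := hadj
    exact Finset.prod_eq_zero (Finset.mem_univ h) (if_neg hh)

theorem tsum_config_weight {w : Sym2 X → ℝ} (hw : ∀ e, 0 ≤ w e)
    (h : ∀ f : X → ℝ, f ≠ 0 →
      |f ⬝ᵥ (Matrix.of fun x y => sqrtKernel G w x y * sqrtKernel G w y x).mulVec f| < f ⬝ᵥ f) :
    ∑' c : EvenConfig G, ENNReal.ofReal ((∏ x, 1 / (2 ^ c.c x * (Nat.factorial (c.c x) : ℝ))) *
        ∏ e ∈ G.edgeFinset, w e ^ c.edgeMult e) =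
      ENNReal.ofReal (1 /
        √(1 - Matrix.of fun x y => sqrtKernel G w x y * sqrtKernel G w y x).det) := by
  classical
  have hK := sqrtKernel_nonneg (G := G) w
  have hpos : ∀ c : X → ℕ, 0 ≤ ∏ x, 1 / (2 ^ c x * (Nat.factorial (c x) : ℝ)) := fun c =>
    Finset.prod_nonneg fun x _ => by positivity
  have hsum := hasSum_even_degreeSum hK h
  rw [← hsum.tsum_eq, ENNReal.ofReal_tsum_of_nonneg
    (fun c => mul_nonneg (hpos c) (degreeSum_nonneg hK _)) hsum.summable,
    ← (EvenConfig.equivSigma G).tsum_eq, ENNReal.tsum_sigma']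
  refine tsum_congr fun c => ?_
  rw [tsum_fintype, ← sum_config_eq_degreeSum, Finset.mul_sum, ENNReal.ofReal_sum_of_nonneg]
  · refine Finset.sum_congr rfl fun π _ => ?_
    rw [prod_edgeFinset_pow _ hw]
    rfl
  · exact fun π _ => mul_nonneg (hpos c) (Finset.prod_nonneg fun _ _ => hK _ _)

end Configurations

/-! ### The energy and the symmetrized transition matrix -/

section Energy

variable {X : Type*} [Fintype X]

theorem energy_eq {C : X → X → ℝ} (κ : X → ℝ) (hC : ∀ x y, C x y = C y x) (f : X → ℝ) :
    energy C κ f = ∑ x, duality C κ x * f x ^ 2 - ∑ x, ∑ y, C x y * (f x * f y) := by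
  have h1 : ∑ x, ∑ y, C x y * f y ^ 2 = ∑ x, ∑ y, C x y * f x ^ 2 := by
    rw [Finset.sum_comm]
    exact Finset.sum_congr rfl fun x _ => Finset.sum_congr rfl fun y _ => by rw [hC]
  have h2 : ∀ x y, C x y * (f x - f y) ^ 2 =
      C x y * f x ^ 2 + C x y * f y ^ 2 - 2 * (C x y * (f x * f y)) := fun x y => by ring
  have h3 : ∑ x, duality C κ x * f x ^ 2 =
      ∑ x, ∑ y, C x y * f x ^ 2 + ∑ x, κ x * f x ^ 2 := by
    rw [← Finset.sum_add_distrib]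
    exact Finset.sum_congr rfl fun x _ => by rw [duality, add_mul, Finset.sum_mul]
  rw [energy, h3]
  simp_rw [h2, Finset.sum_sub_distrib, Finset.sum_add_distrib, ← Finset.mul_sum]
  rw [h1]
  ring

/-- A symmetric matrix dominated by the symmetrized transition matrix is a strict contraction. -/
theorem abs_dotProduct_mulVec_lt {C : X → X → ℝ} {κ : X → ℝ} (hC : ∀ x y, C x y = C y x)
    (hlam : ∀ x, 0 < duality C κ x) (hE : ∀ f : X → ℝ, f ≠ 0 → 0 < energy C κ f)
    {M : Matrix X X ℝ}
    (hM : ∀ x y, |M x y| ≤ C x y / (√(duality C κ x) * √(duality C κ y)))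
    (f : X → ℝ) (hf : f ≠ 0) : |f ⬝ᵥ M.mulVec f| < f ⬝ᵥ f := by
  have hs : ∀ x, 0 < √(duality C κ x) := fun x => Real.sqrt_pos.2 (hlam x)
  -- Division by `√λ_x` turns the diagonal part of the energy into `f ⬝ᵥ f`; absolute values make
  -- the off-diagonal part dominate `|f ⬝ᵥ M f|`.
  have h := hE (fun x => |f x| / √(duality C κ x)) fun h0 => hf <| funext fun x => by
    have h1 := congrFun h0 x
    simpa [(hs x).ne'] using h1
  rw [energy_eq κ hC] at h
  have h1 : ∑ x, duality C κ x * (|f x| / √(duality C κ x)) ^ 2 = f ⬝ᵥ f := by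
    refine Finset.sum_congr rfl fun x _ => ?_
    rw [div_pow, Real.sq_sqrt (hlam x).le, sq_abs, mul_div_cancel₀ _ (hlam x).ne', sq]
  have h2 : |f ⬝ᵥ M.mulVec f| ≤ ∑ x, ∑ y, C x y *
      (|f x| / √(duality C κ x) * (|f y| / √(duality C κ y))) := by
    rw [dotProduct]
    refine (Finset.abs_sum_le_sum_abs _ _).trans (Finset.sum_le_sum fun x _ => ?_)
    rw [Matrix.mulVec, dotProduct, Finset.mul_sum]
    refine (Finset.abs_sum_le_sum_abs _ _).trans (Finset.sum_le_sum fun y _ => ?_)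
    rw [abs_mul, abs_mul]
    calc |f x| * (|M x y| * |f y|)
        ≤ |f x| * (C x y / (√(duality C κ x) * √(duality C κ y)) * |f y|) := by
          gcongr
          exact hM x y
      _ = _ := by
          have := (hs x).ne'
          have := (hs y).ne'
          field_simp
  rw [h1] at h
  linarith

variable [DecidableEq X]

/-- Without loop-edges, `λ_x` is the energy of the indicator of `x`. -/
theorem duality_pos {C : X → X → ℝ} {κ : X → ℝ} (hC : ∀ x y, C x y = C y x)
    (hCd : ∀ x, C x x = 0) (hE : ∀ f : X → ℝ, f ≠ 0 → 0 < energy C κ f) (x : X) :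
    0 < duality C κ x := by
  have h := hE (Pi.single x 1) (by simp)
  rw [energy_eq κ hC] at h
  have h1 : ∑ y, duality C κ y * (Pi.single x 1 : X → ℝ) y ^ 2 = duality C κ x := by
    rw [Finset.sum_eq_single x] <;> simp +contextual
  have h2 : ∑ y, ∑ z, C y z * ((Pi.single x 1 : X → ℝ) y * (Pi.single x 1 : X → ℝ) z) = 0 := by
    refine Finset.sum_eq_zero fun y _ => Finset.sum_eq_zero fun z _ => ?_
    by_cases hy : y = x <;> by_cases hz : z = x <;> simp [hy, hz, hCd]
  rwa [h1, h2, sub_zero] at h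

theorem trace_pow_conj {S S' A B : Matrix X X ℝ} (h : S' * S = 1) (hA : A = S * B * S') (n : ℕ) :
    (A ^ n).trace = (B ^ n).trace := by
  let u : (Matrix X X ℝ)ˣ := ⟨S, S', mul_eq_one_comm.1 h, h⟩
  have hu : A = u * B * (u⁻¹ : (Matrix X X ℝ)ˣ) := hA
  rw [hu, Units.conj_pow, Matrix.trace_units_conj]

theorem det_one_sub_conj {S S' A B : Matrix X X ℝ} (h : S' * S = 1) (hA : A = S * B * S') :
    (1 - A).det = (1 - B).det := by
  have h' : S * S' = 1 := mul_eq_one_comm.1 h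
  have h1 : 1 - A = S * (1 - B) * S' := by
    rw [hA, Matrix.mul_sub, Matrix.sub_mul, Matrix.mul_one, h']
  rw [h1, Matrix.det_mul_right_comm, h', Matrix.one_mul]

end Energy

/-! ### The two Laplace transforms -/

section Main

variable {X : Type*} [Fintype X] [DecidableEq X] {G : SimpleGraph X} [DecidableRel G.Adj]

/-- The edge weights with the edge `e` thinned by the factor `e^{-k_e}`. -/
def thinnedWeight (k : G.edgeSet → ℕ) (P : Matrix X X ℝ) (e : Sym2 X) : ℝ :=
  edgeWeight P e * Real.exp (-(edgeExt k e))

omit [Fintype X] [DecidableEq X] [DecidableRel G.Adj] in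
theorem thinnedWeight_nonneg (k : G.edgeSet → ℕ) (P : Matrix X X ℝ) (e : Sym2 X) :
    0 ≤ thinnedWeight k P e := by
  refine mul_nonneg ?_ (Real.exp_pos _).le
  induction e with
  | _ x y => exact Real.sqrt_nonneg _

/-- The symmetric matrix with the thinned weights of the edges as entries. -/
def symmThinned (k : G.edgeSet → ℕ) (P : Matrix X X ℝ) : Matrix X X ℝ :=
  Matrix.of fun x y => sqrtKernel G (thinnedWeight k P) x y * sqrtKernel G (thinnedWeight k P) y x

variable {C : X → X → ℝ} {κ : X → ℝ}

omit [DecidableEq X] in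
theorem symmThinned_apply (hC : ∀ x y, C x y = C y x) (hC0 : ∀ x y, 0 ≤ C x y)
    (hCe : ∀ x y, ¬ G.Adj x y → C x y = 0) (hlam : ∀ x, 0 < duality C κ x) (k : G.edgeSet → ℕ) (x y : X) :
    symmThinned k (transition C κ) x y =
      C x y / (√(duality C κ x) * √(duality C κ y)) * Real.exp (-(edgeExt k s(x, y))) := by
  by_cases h : G.Adj x y
  · have h1 : symmThinned k (transition C κ) x y = thinnedWeight k (transition C κ) s(x, y) := by
      simp only [symmThinned, sqrtKernel, Matrix.of_apply, if_pos h, if_pos h.symm]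
      rw [Sym2.eq_swap (a := y), Real.mul_self_sqrt (thinnedWeight_nonneg _ _ _)]
    rw [h1, thinnedWeight]
    congr 1
    change √(C x y / duality C κ x * (C y x / duality C κ y)) = _
    rw [hC y x, div_mul_div_comm, Real.sqrt_div (mul_self_nonneg _), Real.sqrt_mul_self (hC0 x y),
      Real.sqrt_mul (hlam x).le]
  · simp [symmThinned, sqrtKernel, h, hCe x y h]

omit [DecidableEq X] in
theorem symmThinned_abs_lt (hC : ∀ x y, C x y = C y x) (hC0 : ∀ x y, 0 ≤ C x y)
    (hCe : ∀ x y, ¬ G.Adj x y → C x y = 0) (hlam : ∀ x, 0 < duality C κ x)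
    (hE : ∀ f : X → ℝ, f ≠ 0 → 0 < energy C κ f) (k : G.edgeSet → ℕ) (f : X → ℝ) (hf : f ≠ 0) :
    |f ⬝ᵥ (symmThinned k (transition C κ)).mulVec f| < f ⬝ᵥ f := by
  refine abs_dotProduct_mulVec_lt hC hlam hE (fun x y => ?_) f hf
  have h0 : 0 ≤ C x y / (√(duality C κ x) * √(duality C κ y)) :=
    div_nonneg (hC0 x y) (by positivity)
  rw [symmThinned_apply hC hC0 hCe hlam, abs_of_nonneg (mul_nonneg h0 (Real.exp_pos _).le)]
  exact mul_le_of_le_one_right h0 (Real.exp_le_one_iff.2 (neg_nonpos.2 (Nat.cast_nonneg _)))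

/-- `P` is symmetric only with respect to `λ`; this conjugation carries traces and determinants over
to a symmetric matrix, where spectral arguments apply. -/
theorem symmThinned_eq_conj (hC : ∀ x y, C x y = C y x) (hC0 : ∀ x y, 0 ≤ C x y)
    (hCe : ∀ x y, ¬ G.Adj x y → C x y = 0) (hlam : ∀ x, 0 < duality C κ x) (k : G.edgeSet → ℕ) :
    symmThinned k (transition C κ) = Matrix.diagonal (fun x => √(duality C κ x)) *
      thinned k (transition C κ) * Matrix.diagonal (fun x => (√(duality C κ x))⁻¹) := by
  ext x y
  have hs : √(duality C κ x) ≠ 0 := (Real.sqrt_pos.2 (hlam x)).ne'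
  have hs' : √(duality C κ y) ≠ 0 := (Real.sqrt_pos.2 (hlam y)).ne'
  have hd : C x y / duality C κ x = C x y / (√(duality C κ x) * √(duality C κ x)) := by
    rw [Real.mul_self_sqrt (hlam x).le]
  rw [symmThinned_apply hC hC0 hCe hlam, Matrix.mul_diagonal, Matrix.diagonal_mul]
  simp only [thinned, transition, Matrix.of_apply]
  rw [hd]
  field_simp

omit [Fintype X] [DecidableEq X] [DecidableRel G.Adj] in
theorem thinned_zero (P : Matrix X X ℝ) : thinned (0 : G.edgeSet → ℕ) P = P := by
  ext x y
  simp [thinned, edgeExt]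

omit [DecidableRel G.Adj] in
theorem diagonal_inv_mul_diagonal (hlam : ∀ x, 0 < duality C κ x) :
    Matrix.diagonal (fun x => (√(duality C κ x))⁻¹) *
      Matrix.diagonal (fun x => √(duality C κ x)) = 1 := by
  rw [Matrix.diagonal_mul_diagonal, ← Matrix.diagonal_one]
  congr 1
  ext x
  exact inv_mul_cancel₀ (Real.sqrt_pos.2 (hlam x)).ne'

theorem det_one_sub_symmThinned (hC : ∀ x y, C x y = C y x) (hC0 : ∀ x y, 0 ≤ C x y)
    (hCe : ∀ x y, ¬ G.Adj x y → C x y = 0) (hlam : ∀ x, 0 < duality C κ x) (k : G.edgeSet → ℕ) :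
    (1 - symmThinned k (transition C κ)).det = (1 - thinned k (transition C κ)).det :=
  det_one_sub_conj (diagonal_inv_mul_diagonal hlam) (symmThinned_eq_conj hC hC0 hCe hlam k)

theorem det_one_sub_thinned_pos (hC : ∀ x y, C x y = C y x) (hC0 : ∀ x y, 0 ≤ C x y)
    (hCe : ∀ x y, ¬ G.Adj x y → C x y = 0) (hlam : ∀ x, 0 < duality C κ x)
    (hE : ∀ f : X → ℝ, f ≠ 0 → 0 < energy C κ f) (k : G.edgeSet → ℕ) :
    0 < (1 - thinned k (transition C κ)).det := by
  rw [← det_one_sub_symmThinned hC hC0 hCe hlam]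
  exact det_one_sub_pos (by ext x y; simp [symmThinned, mul_comm])
    (symmThinned_abs_lt hC hC0 hCe hlam hE k)

theorem hasSum_trace_thinned (hC : ∀ x y, C x y = C y x) (hC0 : ∀ x y, 0 ≤ C x y)
    (hCe : ∀ x y, ¬ G.Adj x y → C x y = 0) (hlam : ∀ x, 0 < duality C κ x)
    (hE : ∀ f : X → ℝ, f ≠ 0 → 0 < energy C κ f) (k : G.edgeSet → ℕ) :
    HasSum (fun n : ℕ => ((thinned k (transition C κ)) ^ (n + 1)).trace / (n + 1))
      (-Real.log (1 - thinned k (transition C κ)).det) := by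
  have h := hasSum_trace_pow_div (M := symmThinned k (transition C κ))
    (by ext x y; simp [symmThinned, mul_comm]) (symmThinned_abs_lt hC hC0 hCe hlam hE k)
  rw [det_one_sub_symmThinned hC hC0 hCe hlam] at h
  simp_rw [trace_pow_conj (diagonal_inv_mul_diagonal hlam)
    (symmThinned_eq_conj hC hC0 hCe hlam k)] at h
  exact h

omit [DecidableEq X] [DecidableRel G.Adj] in
theorem transition_nonneg (hC0 : ∀ x y, 0 ≤ C x y) (hlam : ∀ x, 0 < duality C κ x) (x y : X) :
    0 ≤ transition C κ x y :=
  div_nonneg (hC0 x y) (hlam x).le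

/-- The Laplace transform of the edge occupation field, evaluated on the loop measure. -/
theorem expNeg_lintegral_half_loopMeasure (hC : ∀ x y, C x y = C y x) (hC0 : ∀ x y, 0 ≤ C x y)
    (hCe : ∀ x y, ¬ G.Adj x y → C x y = 0) (hlam : ∀ x, 0 < duality C κ x)
    (hE : ∀ f : X → ℝ, f ≠ 0 → 0 < energy C κ f) (k : G.edgeSet → ℕ) :
    expNeg (∫⁻ l, (1 - expNeg (∑ e : G.edgeSet, k e * (Loop.edgeJumps (e : Sym2 X) l : ℝ≥0∞)))
        ∂((1 / 2 : ℝ≥0∞) • loopMeasure (transition C κ))) =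
      ENNReal.ofReal (√(1 - transition C κ).det / √(1 - thinned k (transition C κ)).det) := by
  have hP := transition_nonneg hC0 hlam
  have hd1 := det_one_sub_thinned_pos hC hC0 hCe hlam hE k
  have hd0 := det_one_sub_thinned_pos hC hC0 hCe hlam hE (0 : G.edgeSet → ℕ)
  have hs0 := hasSum_trace_thinned hC hC0 hCe hlam hE (0 : G.edgeSet → ℕ)
  rw [thinned_zero] at hd0 hs0
  have hsum := hs0.sub (hasSum_trace_thinned hC hC0 hCe hlam hE k)
  simp_rw [← sub_div] at hsum
  -- Thinning decreases the nonnegative entries, hence the traces; nonnegative terms allow the real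
  -- series to be read in `[0,∞]`.
  have hnn : ∀ n : ℕ, 0 ≤ (((transition C κ) ^ (n + 1)).trace -
      ((thinned k (transition C κ)) ^ (n + 1)).trace) / (n + 1) := by
    intro n
    refine div_nonneg (sub_nonneg.2 ?_) (by positivity)
    rw [← sum_prod_cycle, ← sum_prod_cycle]
    exact Finset.sum_le_sum fun ξ _ => Finset.prod_le_prod (fun i _ => thinned_nonneg hP k _ _)
      fun i _ => thinned_le hP k _ _
  have hlog := hsum.nonneg hnn
  rw [lintegral_smul_measure, lintegral_one_sub_expNeg_loopMeasure hP,
    ← ENNReal.ofReal_tsum_of_nonneg hnn hsum.summable, hsum.tsum_eq, smul_eq_mul,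
    show (1 / 2 : ℝ≥0∞) = ENNReal.ofReal (1 / 2) by
      rw [ENNReal.ofReal_div_of_pos two_pos]; simp,
    ← ENNReal.ofReal_mul (by norm_num), expNeg_ofReal (mul_nonneg (by norm_num) hlog)]
  congr 1
  rw [← Real.sqrt_div hd0.le, ← Real.exp_log (Real.sqrt_pos.2 (div_pos hd0 hd1)),
    Real.log_sqrt (div_pos hd0 hd1).le, Real.log_div hd0.ne' hd1.ne']
  congr 1
  ring

/-- The Laplace transform of the edge multiplicities of an even configuration. -/
theorem lintegral_expNeg_evenMeasure (hC : ∀ x y, C x y = C y x) (hC0 : ∀ x y, 0 ≤ C x y)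
    (hCe : ∀ x y, ¬ G.Adj x y → C x y = 0) (hlam : ∀ x, 0 < duality C κ x)
    (hE : ∀ f : X → ℝ, f ≠ 0 → 0 < energy C κ f) (k : G.edgeSet → ℕ) :
    ∫⁻ c, expNeg (∑ e, k e * (c.network e : ℝ≥0∞)) ∂(evenMeasure G (transition C κ)) =
      ENNReal.ofReal (√(1 - transition C κ).det / √(1 - thinned k (transition C κ)).det) := by
  have h := tsum_config_weight (G := G) (thinnedWeight_nonneg k (transition C κ))
    (symmThinned_abs_lt hC hC0 hCe hlam hE k)
  change _ = ENNReal.ofReal (1 / √(1 - symmThinned k (transition C κ)).det) at h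
  rw [det_one_sub_symmThinned hC hC0 hCe hlam] at h
  rw [div_eq_mul_one_div, ENNReal.ofReal_mul (Real.sqrt_nonneg _), ← h, ← ENNReal.tsum_mul_left,
    evenMeasure, lintegral_sum_measure]
  refine tsum_congr fun c => ?_
  -- The exponential is a product over the edges of the map, so it merges with the weight of the
  -- configuration and leaves the total weight for thinned edges.
  have hexp : expNeg (∑ e, k e * (c.network e : ℝ≥0∞)) =
      ENNReal.ofReal (∏ e ∈ G.edgeFinset, Real.exp (-(edgeExt k e)) ^ c.edgeMult e) := by
    rw [expNeg_sum, ENNReal.ofReal_prod_of_nonneg fun e _ => by positivity,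
      Finset.prod_subtype G.edgeFinset (p := fun e => e ∈ G.edgeSet)
        fun e => SimpleGraph.mem_edgeFinset]
    refine Finset.prod_congr rfl fun e _ => ?_
    rw [mul_comm, expNeg_nat_mul, expNeg_natCast, ENNReal.ofReal_pow (Real.exp_pos _).le,
      edgeExt_coe]
    rfl
  rw [lintegral_smul_measure, lintegral_dirac, hexp, smul_eq_mul,
    ← ENNReal.ofReal_mul' (Finset.prod_nonneg fun e _ => by positivity),
    ← ENNReal.ofReal_mul (Real.sqrt_nonneg _)]
  congr 1
  simp_rw [evenWeight, thinnedWeight, mul_pow, Finset.prod_mul_distrib]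
  ring

omit [Fintype X] [DecidableRel G.Adj] in
theorem edgeField_eq_lintegral (L : Measure (Loop X)) (e : G.edgeSet) :
    edgeField G L e = ∫⁻ l, (Loop.edgeJumps (e : Sym2 X) l : ℝ≥0∞) ∂L := by
  obtain ⟨e, he⟩ := e
  induction e with
  | _ x y =>
    change jumpNumber L x y + jumpNumber L y x =
      ∫⁻ l, ((Loop.jumps x y l + Loop.jumps y x l : ℕ) : ℝ≥0∞) ∂L
    simp_rw [Nat.cast_add]
    exact (lintegral_add_left (measurable_from_top.comp (Loop.measurable_jumps x y)) _).symm

omit [Fintype X] [DecidableRel G.Adj] in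
theorem sum_mul_edgeField [Fintype G.edgeSet] (k : G.edgeSet → ℕ) (L : Measure (Loop X)) :
    ∑ e, k e * edgeField G L e =
      ∫⁻ l, ∑ e : G.edgeSet, k e * (Loop.edgeJumps (e : Sym2 X) l : ℝ≥0∞) ∂L := by
  have hm : ∀ e, Measurable fun l : Loop X => (Loop.edgeJumps e l : ℝ≥0∞) := fun e =>
    measurable_from_top.comp (Loop.measurable_edgeJumps e)
  rw [lintegral_finsetSum _ fun e _ => (hm _).const_mul _]
  refine Finset.sum_congr rfl fun e _ => ?_
  rw [lintegral_const_mul _ (hm _), edgeField_eq_lintegral]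

omit [Fintype X] [DecidableRel G.Adj] in
theorem measurable_sum_mul_edgeJumps [Fintype G.edgeSet] (k : G.edgeSet → ℕ) :
    Measurable fun l : Loop X =>
      ∑ e : G.edgeSet, k e * (Loop.edgeJumps (e : Sym2 X) l : ℝ≥0∞) :=
  Finset.measurable_fun_sum _ fun e _ =>
    (measurable_from_top.comp (Loop.measurable_edgeJumps (e : Sym2 X))).const_mul _

omit [Fintype X] [DecidableRel G.Adj] in
theorem IsPoissonProcess.measurable_edgeField {Ω : Type*} [MeasurableSpace Ω] {Pr : Measure Ω}
    {L : Ω → Measure (Loop X)} {ν : Measure (Loop X)} (hL : IsPoissonProcess Pr L ν) :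
    Measurable fun ω => edgeField G (L ω) := by
  refine measurable_pi_lambda _ fun e => ?_
  simp_rw [edgeField_eq_lintegral]
  exact (Measure.measurable_lintegral
    (measurable_from_top.comp (Loop.measurable_edgeJumps (e : Sym2 X)))).comp
    (Measure.measurable_of_measurable_coe L hL.measurable)

/-- At `k = 0` the Laplace transform is the total mass, and the two determinants coincide. -/
theorem isProbabilityMeasure_evenMeasure (hC : ∀ x y, C x y = C y x) (hC0 : ∀ x y, 0 ≤ C x y)
    (hCe : ∀ x y, ¬ G.Adj x y → C x y = 0) (hlam : ∀ x, 0 < duality C κ x)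
    (hE : ∀ f : X → ℝ, f ≠ 0 → 0 < energy C κ f) :
    IsProbabilityMeasure (evenMeasure G (transition C κ)) := by
  have h := lintegral_expNeg_evenMeasure hC hC0 hCe hlam hE (0 : G.edgeSet → ℕ)
  have hd := det_one_sub_thinned_pos hC hC0 hCe hlam hE (0 : G.edgeSet → ℕ)
  rw [thinned_zero] at h hd
  rw [div_self (Real.sqrt_pos.2 hd).ne'] at h
  exact ⟨by simpa using h⟩

theorem map_network_evenMeasure (hC : ∀ x y, C x y = C y x) (hC0 : ∀ x y, 0 ≤ C x y)
    (hCe : ∀ x y, ¬ G.Adj x y → C x y = 0) (hlam : ∀ x, 0 < duality C κ x)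
    (hE : ∀ f : X → ℝ, f ≠ 0 → 0 < energy C κ f)
    {Ω : Type*} [MeasurableSpace Ω] (Pr : Measure Ω) [IsProbabilityMeasure Pr]
    (L : Ω → Measure (Loop X))
    (hL : IsPoissonProcess Pr L ((1 / 2 : ℝ≥0∞) • loopMeasure (transition C κ))) :
    (evenMeasure G (transition C κ)).map (fun c e => (c.network e : ℝ≥0∞)) =
      Pr.map (fun ω => edgeField G (L ω)) := by
  have := isProbabilityMeasure_evenMeasure hC hC0 hCe hlam hE
  refine ext_of_lintegral_expNeg fun k => ?_
  have hm : Measurable fun x : G.edgeSet → ℝ≥0∞ => expNeg (∑ e, k e * x e) :=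
    measurable_expNeg.comp (by fun_prop)
  rw [lintegral_map hm measurable_from_top, lintegral_map hm hL.measurable_edgeField,
    lintegral_expNeg_evenMeasure hC hC0 hCe hlam hE]
  simp_rw [sum_mul_edgeField]
  rw [hL.lintegral_expNeg_lintegral (measurable_sum_mul_edgeJumps k),
    expNeg_lintegral_half_loopMeasure hC hC0 hCe hlam hE]

end Main

end LoopNetwork

end

theorem mainTheorem4 {X : Type*} [Fintype X] [DecidableEq X]
    (G : SimpleGraph X) [DecidableRel G.Adj] (hG : G.Connected)
    (C : X → X → ℝ) (κ : X → ℝ)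
    (hC_symm : ∀ x y, C x y = C y x)
    (hC_nonneg : ∀ x y, 0 ≤ C x y)
    (hC_edge : ∀ x y, ¬ G.Adj x y → C x y = 0)
    (hκ : ∀ x, 0 ≤ κ x)
    (hE : ∀ f : X → ℝ, f ≠ 0 → 0 < LoopNetwork.energy C κ f) :
    IsProbabilityMeasure (LoopNetwork.evenMeasure G (LoopNetwork.transition C κ)) ∧
    ∀ (Ω : Type*) [MeasurableSpace Ω] (Pr : Measure Ω) [IsProbabilityMeasure Pr]
      (L : Ω → Measure (LoopNetwork.Loop X)),
      LoopNetwork.IsPoissonProcess Pr L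
        ((1 / 2 : ℝ≥0∞) • LoopNetwork.loopMeasure (LoopNetwork.transition C κ)) →
      (LoopNetwork.evenMeasure G (LoopNetwork.transition C κ)).map
          (fun c e => (c.network e : ℝ≥0∞)) =
        Pr.map (fun ω => LoopNetwork.edgeField G (L ω)) := by
  -- Irreflexivity of adjacency gives `C x x = 0`.
  have hlam := LoopNetwork.duality_pos (κ := κ) hC_symm (fun x => hC_edge x x (G.irrefl)) hE
  exact ⟨LoopNetwork.isProbabilityMeasure_evenMeasure hC_symm hC_nonneg hC_edge hlam hE,
    fun Ω _ Pr _ L hL =>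
      LoopNetwork.map_network_evenMeasure hC_symm hC_nonneg hC_edge hlam hE Pr L hL⟩
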